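/- **Setting.** Let $\Omega$ be a set, $\sigma:\Omega\to\Omega$ an invertible map, and for each $\omega\in\Omega$ let $(X_\omega,\|\cdot\|)$ be a complex Banach space with a second norm $|\cdot|$ such that $|\cdot|\le\|\cdot\|$ and the closed $\|\cdot\|$-unit ball is $|\cdot|$-closed (a normal Saks space). Let $\mathrm{End}(\mathbb X,\sigma)$ be the set of families $L=(L_\omega)_{\omega\in\Omega}$ of bounded linear maps $L_\omega:X_\omega\to X_{\sigma(\omega)}$, and put $L^n_\omega=L_{\sigma^{n-1}(\omega)}\circ\cdots\circ L_\omega$. The triple norm of an operator is $|||A|||=\sup_{\|f\|=1}|Af|$. * $L$ is *Saks space equicontinuous* if $\sup_\omega\|L_\omega\|<\infty$ and for each $\eta>0$ there is $C_\eta>0$ with $|L_\omega f|\le\eta\|f\|+C_\eta|f|$ for all $\omega$ and $f\in X_\omega$. * For $C_1,C_2,r,R\ge0$, $\mathcal{LY}(C_1,C_2,r,R)$ is the set of $L\in\mathrm{End}(\mathbb X,\sigma)$ with $\|L^n_\omega f\|\le C_1r^n\|f\|+C_2R^n|f|$ for all $\omega$, $f\in X_\omega$, $n\ge1$. * $\mathcal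 O_\epsilon(L)=\{S\in\mathrm{End}(\mathbb X,\sigma):\sup_\omega|||L_\omega-S_\omega|||<\epsilon\}$. * For complementary closed subspaces, $\Pi_{E\|F}$ is the projection onto $E$ along $F$. For closed subspaces $E,F$, $d_H(E,F)$ is the Hausdorff distance between the $\|\cdot\|$-unit spheres of $E$ and $F$. * Let $d\ge1$ and $0\le\mu<\lambda$. Families of $d$-dimensional subspaces $E_\omega\subseteq X_\omega$ (fast spaces) and closed $d$-codimensional subspaces $F_\omega\subseteq X_\omega$ (slow spaces) form a *$(\mu,\lambda,d)$-hyperbolic splitting* for $L$ if there are $C_\lambda,C_\mu,\Theta>0$ such that for all $\omega$ and all $n\ge1$: $E_\omega\oplus F_\omega=X_\omega$ and $\max\{\|\Pi_{F_\omega\|E_\omega}\|,\|\Pi_{E_\omega\|F_\omega}\|\}\le\Theta$; $L_\omega E_\omega=E_{\sigma(\omega)}$ and $\|L^n_\omega f\|\ge C_\lambda\lambda^n\|f\|$ for $f\in E_\omega$; $L_\omega F_\omega\subseteq F_{\sigma(\omega)}$ and $\|L^n_\omega|_{F_\omega}\|\le C_\mu\mu^n$. A *hyperbolic splitting of index $d$*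 is a $(\mu',\lambda',d)$-hyperbolic splitting for some $0\le\mu'<\lambda'$. **Theorem.** Let $C_1,C_2,R\ge0$, $0\le r<\mu<\lambda$ and $d\ge1$. Suppose that $L\in\mathcal{LY}(C_1,C_2,r,R)$ is Saks space equicontinuous and has a $(\mu,\lambda,d)$-hyperbolic splitting with fast spaces $(E_\omega)$ and slow spaces $(F_\omega)$. Then there exists $\epsilon'>0$ such that: 1. every $S\in\mathcal{LY}(C_1,C_2,r,R)\cap\mathcal O_{\epsilon'}(L)$ has a hyperbolic splitting of index $d$; 2. there is $M<\infty$ such that $\|\Pi_{E^S_\omega\|F^S_\omega}\|\le M$ for every $S\in\mathcal{LY}(C_1,C_2,r,R)\cap\mathcal O_{\epsilon'}(L)$, every index-$d$ hyperbolic splitting of $S$ into fast spaces $(E^S_\omega)$ and slow spaces $(F^S_\omega)$, and every $\omega\in\Omega$. Moreover, for every $\beta\in(0,(\lambda-\mu)/2)$ there is $C_\beta>0$ such that for every $\delta>0$ there is $\epsilon_{\beta,\delta}\in(0,\epsilon')$ with the following property. For every $S\in\mathcal{LY}(C_1,C_2,r,R)\cap\mathcal O_{\epsilon_{\beta,\delta}}(L)$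 and every index-$d$ hyperbolic splitting of $S$ into fast spaces $(E^S_\omega)$ and slow spaces $(F^S_\omega)$: 1. $\displaystyle\sup_{\omega}|||\Pi_{E^S_\omega\|F^S_\omega}-\Pi_{E_\omega\|F_\omega}|||\le\delta$ and $\displaystyle\sup_\omega d_H(F^S_\omega,F_\omega)\le\delta$; 2. $(E^S_\omega)$ and $(F^S_\omega)$ form a $(\mu+\beta,\lambda-\beta,d)$-hyperbolic splitting for $S$; more specifically, for all $\omega\in\Omega$ and $n\ge1$, $\|S^n_\omega|_{F^S_\omega}\|\le C_\beta(\mu+\beta)^n$, and $\|S^n_\omega v\|\ge C_\beta^{-1}(\lambda-\beta)^n\|v\|$ for every $v\in E^S_\omega$. -/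

import Mathlib

open scoped ENNReal Topology

noncomputable section

namespace SaksStability

section SaksSpace

variable {X : Type*} [NormedAddCommGroup X] [NormedSpace ℂ X]

/-- The topology on `X` induced by a seminorm `w`. -/
abbrev seminormTopology (w : Seminorm ℂ X) : TopologicalSpace X :=
  w.toAddGroupSeminorm.toSeminormedAddCommGroup.toUniformSpace.toTopologicalSpace

/-- `(X, ‖·‖, w)` is a normal (normed) Saks space: `w` is a norm, the closed `‖·‖`-unit ball is
`w`-closed, and `w ≤ ‖·‖` (so that the unit ball is also `w`-bounded). -/
structure IsNormalSaks (w : Seminorm ℂ X) : Prop where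
  eq_zero_of_eq_zero : ∀ x : X, w x = 0 → x = 0
  isClosed_unitBall : IsClosed[seminormTopology w] (Metric.closedBall (0 : X) 1)
  le_norm : ∀ x : X, w x ≤ ‖x‖

/-- The `d`-dimensional subspaces of `X` (these are automatically closed). -/
def grassmannianDim (X : Type*) [NormedAddCommGroup X] [NormedSpace ℂ X] (d : ℕ) :
    Set (Submodule ℂ X) :=
  {E | FiniteDimensional ℂ E ∧ Module.finrank ℂ E = d}

/-- The closed `d`-codimensional subspaces of `X`. -/
def grassmannianCodim (X : Type*) [NormedAddCommGroup X] [NormedSpace ℂ X] (d : ℕ) :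
    Set (Submodule ℂ X) :=
  {F | IsClosed (F : Set X) ∧ FiniteDimensional ℂ (X ⧸ F) ∧ Module.finrank ℂ (X ⧸ F) = d}

/-- The Grassmannian distance `d_H(E, F)`: the Hausdorff distance of the unit spheres of `E`
and `F`, with values in `[0, ∞]`. -/
def grassmannianDist (E F : Submodule ℂ X) : ℝ≥0∞ :=
  max (⨆ e : X, ⨆ _ : e ∈ E ∧ ‖e‖ = 1, ⨅ f : X, ⨅ _ : f ∈ F ∧ ‖f‖ = 1, ENNReal.ofReal ‖e - f‖)
    (⨆ f : X, ⨆ _ : f ∈ F ∧ ‖f‖ = 1, ⨅ e : X, ⨅ _ : e ∈ E ∧ ‖e‖ = 1, ENNReal.ofReal ‖e - f‖)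

/-- The triple norm of `A : X → Y`, i.e. the operator norm from `(X, ‖·‖)` to `(Y, w)`, with
values in `[0, ∞]`. -/
def tripleNorm {Y : Type*} [NormedAddCommGroup Y] [NormedSpace ℂ Y] (w : Seminorm ℂ Y)
    (A : X →L[ℂ] Y) : ℝ≥0∞ :=
  ⨆ f : X, ⨆ _ : ‖f‖ = 1, ENNReal.ofReal (w (A f))

end SaksSpace

section Bundle

variable {Ω : Type*} {X : Ω → Type*} [∀ ω, NormedAddCommGroup (X ω)] [∀ ω, NormedSpace ℂ (X ω)]

/-- Bounded linear endomorphisms covering `σ` of the bundle with fibres `X ω`, given by their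
fibre maps `L ω : X ω → X (σ ω)`. -/
abbrev BundleEnd (X : Ω → Type*) [∀ ω, NormedAddCommGroup (X ω)] [∀ ω, NormedSpace ℂ (X ω)]
    (σ : Equiv.Perm Ω) :=
  ∀ ω, X ω →L[ℂ] X (σ ω)

variable {σ : Equiv.Perm Ω}

/-- The `n`-th iterate `L_{σ^{n-1} ω} ∘ ⋯ ∘ L_{σ ω} ∘ L_ω : X ω → X (σ^n ω)`. -/
def cocycle (L : BundleEnd X σ) : (n : ℕ) → (ω : Ω) → X ω →L[ℂ] X (σ^[n] ω)
  | 0, ω => ContinuousLinearMap.id ℂ (X ω)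
  | n + 1, ω => (cocycle L n (σ ω)).comp (L ω)

/-- The families `E` (fast spaces) and `F` (slow spaces) form a `(μ, lam, d)`-hyperbolic
splitting for `L`. -/
structure IsHyperbolicSplitting (L : BundleEnd X σ) (μ lam : ℝ) (d : ℕ)
    (E F : ∀ ω, Submodule ℂ (X ω)) : Prop where
  index_pos : 0 < d
  rate_nonneg : 0 ≤ μ
  rate_lt : μ < lam
  fast_mem : ∀ ω, E ω ∈ grassmannianDim (X ω) d
  slow_mem : ∀ ω, F ω ∈ grassmannianCodim (X ω) d
  isTopCompl : ∀ ω, (E ω).IsTopCompl (F ω)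
  projection_bound : ∃ Θ > 0, ∀ ω,
    max ‖(F ω).projectionL (E ω) (isTopCompl ω).symm‖ ‖(E ω).projectionL (F ω) (isTopCompl ω)‖ ≤ Θ
  fast_map : ∀ ω, (E ω).map (L ω : X ω →ₗ[ℂ] X (σ ω)) = E (σ ω)
  fast_expansion : ∃ C > 0, ∀ ω, ∀ n : ℕ, 1 ≤ n → ∀ f ∈ E ω,
    C * lam ^ n * ‖f‖ ≤ ‖cocycle L n ω f‖
  slow_map : ∀ ω, (F ω).map (L ω : X ω →ₗ[ℂ] X (σ ω)) ≤ F (σ ω)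
  slow_decay : ∃ C > 0, ∀ ω, ∀ n : ℕ, 1 ≤ n →
    ‖(cocycle L n ω).comp (F ω).subtypeL‖ ≤ C * μ ^ n

/-- `L` has a hyperbolic splitting of index `d`. -/
def HasHyperbolicSplitting (L : BundleEnd X σ) (d : ℕ) : Prop :=
  ∃ (μ lam : ℝ) (E F : ∀ ω, Submodule ℂ (X ω)), IsHyperbolicSplitting L μ lam d E F

/-- `L` is a Saks space equicontinuous endomorphism (with respect to the weak norms `w ω`). -/
structure IsSaksEquicontinuous (w : ∀ ω, Seminorm ℂ (X ω)) (L : BundleEnd X σ) : Prop where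
  norm_bound : ∃ M : ℝ, ∀ ω, ‖L ω‖ ≤ M
  weak_bound : ∀ η > 0, ∃ C > 0, ∀ ω, ∀ f : X ω, w (σ ω) (L ω f) ≤ η * ‖f‖ + C * w ω f

/-- The Lasota-Yorke class `LY(C₁, C₂, r, R)`. -/
def lasotaYorke (w : ∀ ω, Seminorm ℂ (X ω)) (σ : Equiv.Perm Ω) (C₁ C₂ r R : ℝ) :
    Set (BundleEnd X σ) :=
  {L | ∀ ω, ∀ f : X ω, ∀ n : ℕ, 1 ≤ n →
    ‖cocycle L n ω f‖ ≤ C₁ * r ^ n * ‖f‖ + C₂ * R ^ n * w ω f}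

/-- The set `O_ε(L)` of endomorphisms that are uniformly `ε`-close to `L` in the triple norm. -/
def tripleBall (w : ∀ ω, Seminorm ℂ (X ω)) (L : BundleEnd X σ) (ε : ℝ) : Set (BundleEnd X σ) :=
  {S | (⨆ ω, tripleNorm (w (σ ω)) (L ω - S ω)) < ENNReal.ofReal ε}

end Bundle

end SaksStability

end

/-! Hyperbolicity is traded for invertibility. Let `A` act on the bounded sections `lp X ∞` through
the cocycle divided by a rate ρ. If ρ lies inside the gap of a splitting, `1 - A` is invertible: sum
forward along slow spaces and backward along fast ones (`Dichotomy.isUnit_one_sub`). Conversely,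
over an aperiodic base the inverse `T` is a Green operator whose diagonal blocks are the slow
projections of a dichotomy at rate ρ (`IsSectionOperator.dichotomy`). Aperiodicity is arranged by
replacing `σ` with (k, ω) ↦ (k + 1, σ ω) on ℤ × Ω.

It remains to perturb an inverse (`exists_inverse_one_sub_of_weakly_close`), by an argument of
Keller-Liverani type. If `B` is the perturbed operator, ∑_{k<n} B^k + B^n T inverts `1 - B` from the
right and the left up to B^n (A - B) T and B^n T (A - B). The Lasota-Yorke inequality lets B^n turn
weak smallness into strong smallness. The new inverse, hence the new projections, are weakly close
to the old ones.

One rate ρ yields no gap, so two rates ρ₁ < ρ₂ are used. The weak norm controls the strong norm on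
fast spaces, so weakly close projections have fast spaces of equal dimension d. Dichotomies at ρ₁
and ρ₂ have nested fast spaces, which then coincide: one projection decays at ρ₁ and expands at ρ₂.
The same uniqueness (`Dichotomy.eq_of_finrank_eq`) removes the dependence on the integer coordinate
and identifies every index-d splitting of the perturbation with the constructed one. -/

noncomputable section

namespace SaksStability

/-! ### Stability of the inverse of `1 - A` for a single operator -/

section Abstract

variable {Y : Type*} [NormedAddCommGroup Y] [NormedSpace ℂ Y]

/-- `A` is continuous on bounded sets for the topology of the seminorm `W`. -/
def WeaklyContinuous (W : Seminorm ℂ Y) (A : Y →L[ℂ] Y) : Prop :=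
  ∀ η > 0, ∃ C > 0, ∀ f, W (A f) ≤ η * ‖f‖ + C * W f

/-- A Lasota-Yorke inequality for the iterates of a single operator. -/
def LasotaYorkeBound (W : Seminorm ℂ Y) (C₁ C₂ r R : ℝ) (A : Y →L[ℂ] Y) : Prop :=
  ∀ n : ℕ, 1 ≤ n → ∀ f, ‖(A ^ n) f‖ ≤ C₁ * r ^ n * ‖f‖ + C₂ * R ^ n * W f

theorem WeaklyContinuous.one (W : Seminorm ℂ Y) : WeaklyContinuous W 1 := by
  intro η hη
  refine ⟨1, one_pos, fun f => ?_⟩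
  have : 0 ≤ η * ‖f‖ := by positivity
  simpa using this

theorem WeaklyContinuous.add {W : Seminorm ℂ Y} {A B : Y →L[ℂ] Y}
    (hA : WeaklyContinuous W A) (hB : WeaklyContinuous W B) : WeaklyContinuous W (A + B) := by
  intro η hη
  obtain ⟨C, hC, h⟩ := hA (η / 2) (by positivity)
  obtain ⟨D, hD, h'⟩ := hB (η / 2) (by positivity)
  refine ⟨C + D, by positivity, fun f => ?_⟩
  have := map_add_le_add W (A f) (B f)
  have := h f
  have := h' f
  rw [add_apply]
  linarith

theorem WeaklyContinuous.mul {W : Seminorm ℂ Y} {A B : Y →L[ℂ] Y}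
    (hA : WeaklyContinuous W A) (hB : WeaklyContinuous W B) : WeaklyContinuous W (A * B) := by
  intro η hη
  obtain ⟨C, hC, h⟩ := hA (η / (2 * (‖B‖ + 1))) (by positivity)
  obtain ⟨D, hD, h'⟩ := hB (η / (2 * C)) (by positivity)
  refine ⟨C * D, by positivity, fun f => ?_⟩
  have h1 : W (A (B f)) ≤ η / (2 * (‖B‖ + 1)) * ‖B f‖ + C * W (B f) := h (B f)
  have h2 : C * W (B f) ≤ C * (η / (2 * C) * ‖f‖ + D * W f) := by gcongr; exact h' f
  have h3 : η / (2 * (‖B‖ + 1)) * ‖B f‖ ≤ η / (2 * (‖B‖ + 1)) * ((‖B‖ + 1) * ‖f‖) := by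
    gcongr
    exact (B.le_opNorm f).trans (by gcongr; linarith)
  have h4 : η / (2 * (‖B‖ + 1)) * ((‖B‖ + 1) * ‖f‖) = η / 2 * ‖f‖ := by
    have : ‖B‖ + 1 ≠ 0 := by positivity
    field_simp
  have h5 : C * (η / (2 * C) * ‖f‖ + D * W f) = η / 2 * ‖f‖ + C * D * W f := by
    field_simp
  change W (A (B f)) ≤ _
  linarith

theorem WeaklyContinuous.pow {W : Seminorm ℂ Y} {A : Y →L[ℂ] Y}
    (hA : WeaklyContinuous W A) (n : ℕ) : WeaklyContinuous W (A ^ n) := by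
  induction n with
  | zero => simpa using WeaklyContinuous.one W
  | succ k ih => rw [pow_succ]; exact ih.mul hA

theorem WeaklyContinuous.geom_sum {W : Seminorm ℂ Y} {A : Y →L[ℂ] Y}
    (hA : WeaklyContinuous W A) (n : ℕ) :
    WeaklyContinuous W (∑ k ∈ Finset.range n, A ^ k) := by
  induction n with
  | zero =>
    intro η hη
    refine ⟨1, one_pos, fun f => ?_⟩
    have := apply_nonneg W f
    simp only [Finset.range_zero, Finset.sum_empty, zero_apply, map_zero]
    positivity
  | succ k ih => rw [Finset.sum_range_succ]; exact ih.add (hA.pow k)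

theorem exists_pow_mul_le {r : ℝ} (hr : 0 ≤ r) (hr1 : r < 1) (M : ℝ) {η : ℝ} (hη : 0 < η) :
    ∃ n : ℕ, 1 ≤ n ∧ M * r ^ n ≤ η := by
  have h : Filter.Tendsto (fun n : ℕ => M * r ^ n) Filter.atTop (𝓝 (M * 0)) :=
    (tendsto_pow_atTop_nhds_zero_of_lt_one hr hr1).const_mul M
  rw [mul_zero] at h
  obtain ⟨n, hn, hn1⟩ := ((h.eventually (ge_mem_nhds hη)).and
    (Filter.eventually_ge_atTop 1)).exists
  exact ⟨n, hn1, hn⟩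

/-- The inverse of `1 - A` is weakly continuous when `A` is and satisfies a Lasota-Yorke bound. -/
theorem WeaklyContinuous.of_mul_one_sub_eq_one {W : Seminorm ℂ Y} {C₁ C₂ r R : ℝ}
    (hr : 0 ≤ r) (hr1 : r < 1) (hC₂ : 0 ≤ C₂) (hR : 0 ≤ R) {A T : Y →L[ℂ] Y}
    (hW : ∀ f, W f ≤ ‖f‖) (hT : T * (1 - A) = 1) (hA : WeaklyContinuous W A)
    (hLY : LasotaYorkeBound W C₁ C₂ r R A) : WeaklyContinuous W T := by
  -- The finite sum is weakly continuous. In the tail, Lasota-Yorke makes the strong part of A^n f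
  -- small and leaves a multiple of `W f`.
  have key (n : ℕ) : T = ∑ k ∈ Finset.range n, A ^ k + T * A ^ n := by
    have h := congrArg (T * ·) (mul_neg_geom_sum A n)
    simp only [← mul_assoc, hT, one_mul, mul_sub, mul_one] at h
    rw [h]; abel
  intro η hη
  obtain ⟨n, hn1, hn⟩ := exists_pow_mul_le hr hr1 (‖T‖ * C₁) (half_pos hη)
  obtain ⟨C, hC, h⟩ := hA.geom_sum n (η / 2) (by positivity)
  refine ⟨C + ‖T‖ * (C₂ * R ^ n), by positivity, fun f => ?_⟩
  have e : T f = (∑ k ∈ Finset.range n, A ^ k) f + T ((A ^ n) f) :=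
    congrArg (fun M : Y →L[ℂ] Y => M f) (key n)
  have h1 : W (T ((A ^ n) f)) ≤ ‖T‖ * (C₁ * r ^ n * ‖f‖ + C₂ * R ^ n * W f) :=
    (hW _).trans ((T.le_opNorm _).trans (by gcongr; exact hLY n hn1 f))
  have h2 := map_add_le_add W ((∑ k ∈ Finset.range n, A ^ k) f) (T ((A ^ n) f))
  have h3 := h f
  have h4 : ‖T‖ * C₁ * r ^ n * ‖f‖ ≤ η / 2 * ‖f‖ := by gcongr
  rw [e]
  nlinarith

/-- One product supplies a right inverse of `a`, the other a left inverse, so an approximate inverse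
with two different errors suffices. -/
theorem isUnit_of_mul_isUnit_of_isUnit_mul {M : Type*} [Monoid M] {a g : M}
    (h₁ : IsUnit (a * g)) (h₂ : IsUnit (g * a)) : IsUnit a := by
  obtain ⟨u, hu⟩ := h₁
  obtain ⟨v, hv⟩ := h₂
  have hr : a * (g * ↑u⁻¹) = 1 := by rw [← mul_assoc, ← hu, Units.mul_inv]
  have hl : (↑v⁻¹ * g) * a = 1 := by rw [mul_assoc, ← hv, Units.inv_mul]
  have e : ↑v⁻¹ * g = g * ↑u⁻¹ := left_inv_eq_right_inv hl hr
  exact ⟨⟨a, g * ↑u⁻¹, hr, by rw [← e, hl]⟩, rfl⟩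

/-- Makes all constants below uniform over the Lasota-Yorke class. The summand 1 covers n = 0, where
the inequality is not assumed. -/
theorem LasotaYorkeBound.norm_pow_le {W : Seminorm ℂ Y} {C₁ C₂ r R : ℝ} (hC₁ : 0 ≤ C₁)
    (hC₂ : 0 ≤ C₂) (hr : 0 ≤ r) (hR : 0 ≤ R) (hW : ∀ f, W f ≤ ‖f‖) {B : Y →L[ℂ] Y}
    (hB : LasotaYorkeBound W C₁ C₂ r R B) (n : ℕ) :
    ‖B ^ n‖ ≤ 1 + C₁ * r ^ n + C₂ * R ^ n := by
  refine ContinuousLinearMap.opNorm_le_bound _ (by positivity) fun f => ?_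
  rcases Nat.eq_zero_or_pos n with rfl | hn
  · simp only [pow_zero, one_apply_eq_self, mul_one]
    nlinarith [mul_nonneg hC₁ (norm_nonneg f), mul_nonneg hC₂ (norm_nonneg f)]
  · have h1 := hB n hn f
    have h2 : C₂ * R ^ n * W f ≤ C₂ * R ^ n * ‖f‖ := by gcongr; exact hW f
    nlinarith [norm_nonneg f]

set_option maxHeartbeats 1000000 in
/-- Stability of the invertibility of `1 - A` under perturbations that are small in the triple
norm and satisfy a common Lasota-Yorke bound. -/
theorem exists_inverse_one_sub_of_weakly_close [CompleteSpace Y] {W : Seminorm ℂ Y}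
    {C₁ C₂ r R : ℝ} (hC₁ : 0 ≤ C₁) (hC₂ : 0 ≤ C₂) (hr : 0 ≤ r) (hr1 : r < 1) (hR : 0 ≤ R)
    (hW : ∀ f, W f ≤ ‖f‖) {A T : Y →L[ℂ] Y} (hTl : T * (1 - A) = 1) (hTr : (1 - A) * T = 1)
    (hA : WeaklyContinuous W A) (hLY : LasotaYorkeBound W C₁ C₂ r R A) :
    ∃ K > 0, ∀ δ > 0, ∃ ε > 0, ∀ B : Y →L[ℂ] Y, LasotaYorkeBound W C₁ C₂ r R B →
      (∀ f, W ((A - B) f) ≤ ε * ‖f‖) →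
      ∃ T' : Y →L[ℂ] Y, T' * (1 - B) = 1 ∧ (1 - B) * T' = 1 ∧ ‖T'‖ ≤ K ∧
        ∀ f, W ((T' - T) f) ≤ δ * ‖f‖ := by
  have hT : WeaklyContinuous W T := .of_mul_one_sub_eq_one hr hr1 hC₂ hR hW hTl hA hLY
  set b : ℕ → ℝ := fun k => 1 + C₁ * r ^ k + C₂ * R ^ k with hb
  have hb0 (k : ℕ) : 0 < b k := by positivity
  set m : ℝ := ‖A‖ + b 1 with hm
  have hm0 : 0 < m := by have := hb0 1; positivity
  -- The power n is fixed by `A`, `T` and the class alone; it makes the strong part of both errors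
  -- at most 1/4. The parameter ε later handles the weak part.
  obtain ⟨n, hn1, hn⟩ := exists_pow_mul_le hr hr1 (C₁ * (m * ‖T‖)) (show (0 : ℝ) < 1 / 4 by norm_num)
  set c : ℝ := C₂ * R ^ n with hc
  have hc0 : 0 ≤ c := by positivity
  set G₀ : ℝ := ∑ k ∈ Finset.range n, b k + b n * ‖T‖ with hG₀
  have hG₀0 : 0 < G₀ := by
    have : 0 < ∑ k ∈ Finset.range n, b k :=
      Finset.sum_pos (fun k _ => hb0 k) ⟨0, by simp; omega⟩
    have := (hb0 n).le
    positivity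
  -- In the left error `T` acts after the weakly small `A - B`, so weak continuity of `T` is needed
  -- to keep that smallness.
  obtain ⟨D, hD, hTD⟩ := hT (1 / (8 * (c + 1) * m)) (by positivity)
  refine ⟨2 * G₀, by positivity, fun δ hδ => ?_⟩
  obtain ⟨D', hD', hTD'⟩ := hT (δ / (4 * m * G₀)) (by positivity)
  refine ⟨min (1 / (8 * (c + 1) * (‖T‖ + D + 1))) (δ / (4 * D' * G₀)), by positivity,
    fun B hB hAB => ?_⟩
  set ε := min (1 / (8 * (c + 1) * (‖T‖ + D + 1))) (δ / (4 * D' * G₀)) with hε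
  have hε0 : 0 < ε := by positivity
  have hε1 : (c + 1) * (‖T‖ + D + 1) * ε ≤ 1 / 8 := by
    have := min_le_left (1 / (8 * (c + 1) * (‖T‖ + D + 1))) (δ / (4 * D' * G₀))
    rw [← hε, le_div_iff₀ (by positivity)] at this
    linarith
  have hε2 : 4 * D' * G₀ * ε ≤ δ := by
    have := min_le_right (1 / (8 * (c + 1) * (‖T‖ + D + 1))) (δ / (4 * D' * G₀))
    rw [← hε, le_div_iff₀ (by positivity)] at this
    linarith
  have hbB (k : ℕ) : ‖B ^ k‖ ≤ b k := hB.norm_pow_le hC₁ hC₂ hr hR hW k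
  have hABm (f : Y) : ‖(A - B) f‖ ≤ m * ‖f‖ := by
    refine (ContinuousLinearMap.le_opNorm _ _).trans ?_
    gcongr
    have h1 := hbB 1
    rw [pow_one] at h1
    exact (norm_sub_le A B).trans (by linarith)
  set N : Y →L[ℂ] Y := B ^ n * ((A - B) * T) with hN
  set N' : Y →L[ℂ] Y := B ^ n * (T * (A - B)) with hN'
  -- Truncated Neumann series of `B`, with the unknown tail B^n (1 - B)⁻¹ replaced by B^n T.
  set G : Y →L[ℂ] Y := ∑ k ∈ Finset.range n, B ^ k + B ^ n * T with hG
  have hGr : (1 - B) * G = 1 + N := by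
    have h1 : (1 - B) * B ^ n = B ^ n * (1 - B) :=
      ((Commute.one_left _).sub_left (Commute.refl B |>.pow_right n)).eq
    have h2 : (1 - B) * T = 1 + (A - B) * T := by
      rw [show 1 - B = (1 - A) + (A - B) by abel, add_mul, hTr]
    rw [hG, mul_add, mul_neg_geom_sum, ← mul_assoc, h1, mul_assoc, h2, hN]
    noncomm_ring
  have hGl : G * (1 - B) = 1 + N' := by
    have h2 : T * (1 - B) = 1 + T * (A - B) := by
      rw [show 1 - B = (1 - A) + (A - B) by abel, mul_add, hTl]
    rw [hG, add_mul, geom_sum_mul_neg, mul_assoc, h2, hN']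
    noncomm_ring
  have hNle : ‖N‖ ≤ 1 / 2 := by
    refine ContinuousLinearMap.opNorm_le_bound _ (by norm_num) fun f => ?_
    have h1 : ‖N f‖ ≤ C₁ * r ^ n * ‖(A - B) (T f)‖ + c * W ((A - B) (T f)) := hB n hn1 _
    have h2 : C₁ * r ^ n * ‖(A - B) (T f)‖ ≤ C₁ * r ^ n * (m * (‖T‖ * ‖f‖)) := by
      gcongr
      exact (hABm _).trans (by gcongr; exact T.le_opNorm f)
    have h3 : c * W ((A - B) (T f)) ≤ c * (ε * (‖T‖ * ‖f‖)) := by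
      gcongr
      exact (hAB _).trans (by gcongr; exact T.le_opNorm f)
    have h4 : C₁ * (m * ‖T‖) * r ^ n * ‖f‖ ≤ 1 / 4 * ‖f‖ := by gcongr
    have h5 : c * ‖T‖ * ε ≤ (c + 1) * (‖T‖ + D + 1) * ε := by
      gcongr <;> linarith
    have h6 : c * ‖T‖ * ε * ‖f‖ ≤ 1 / 8 * ‖f‖ := by gcongr; linarith
    nlinarith [norm_nonneg f]
  have hTAB {η E : ℝ} (hη : 0 ≤ η) (hE : 0 ≤ E) (h : ∀ f, W (T f) ≤ η * ‖f‖ + E * W f) (f : Y) :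
      W (T ((A - B) f)) ≤ (η * m + E * ε) * ‖f‖ := by
    calc W (T ((A - B) f)) ≤ η * ‖(A - B) f‖ + E * W ((A - B) f) := h _
      _ ≤ η * (m * ‖f‖) + E * (ε * ‖f‖) := by gcongr; exacts [hABm f, hAB f]
      _ = _ := by ring
  have hN'le : ‖N'‖ ≤ 1 / 2 := by
    refine ContinuousLinearMap.opNorm_le_bound _ (by norm_num) fun f => ?_
    have h1 : ‖N' f‖ ≤ C₁ * r ^ n * ‖T ((A - B) f)‖ + c * W (T ((A - B) f)) := hB n hn1 _
    have h2 : C₁ * r ^ n * ‖T ((A - B) f)‖ ≤ C₁ * r ^ n * (‖T‖ * (m * ‖f‖)) := by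
      gcongr
      exact (T.le_opNorm _).trans (by gcongr; exact hABm f)
    have h3 : c * W (T ((A - B) f)) ≤ (c + 1) * ((1 / (8 * (c + 1) * m) * m + D * ε) * ‖f‖) := by
      gcongr
      · linarith
      · exact hTAB (by positivity) hD.le hTD f
    have h4 : C₁ * (m * ‖T‖) * r ^ n * ‖f‖ ≤ 1 / 4 * ‖f‖ := by gcongr
    have h5 : (c + 1) * D * ε ≤ (c + 1) * (‖T‖ + D + 1) * ε := by
      gcongr
      linarith [norm_nonneg T]
    have h6 : (c + 1) * D * ε * ‖f‖ ≤ 1 / 8 * ‖f‖ := by gcongr; linarith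
    have h7 : (c + 1) * ((1 / (8 * (c + 1) * m) * m + D * ε) * ‖f‖) =
        1 / 8 * ‖f‖ + (c + 1) * D * ε * ‖f‖ := by
      have e : (c + 1) * (1 / (8 * (c + 1) * m) * m) = 1 / 8 := by field_simp
      linear_combination ‖f‖ * e
    nlinarith [norm_nonneg f]
  have hunit {M : Y →L[ℂ] Y} (hM : ‖M‖ ≤ 1 / 2) : IsUnit (1 + M) := by
    have : ‖-M‖ < 1 := by rw [norm_neg]; linarith
    simpa using isUnit_one_sub_of_norm_lt_one this
  have hU : IsUnit (1 - B) := isUnit_of_mul_isUnit_of_isUnit_mul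
    (by rw [hGr]; exact hunit hNle) (by rw [hGl]; exact hunit hN'le)
  obtain ⟨u, hu⟩ := hU
  set T' : Y →L[ℂ] Y := ↑u⁻¹ with hT'
  have hT'l : T' * (1 - B) = 1 := by rw [← hu, hT', Units.inv_mul]
  have hT'r : (1 - B) * T' = 1 := by rw [← hu, hT', Units.mul_inv]
  have hGn : ‖G‖ ≤ G₀ := by
    refine (norm_add_le _ _).trans (add_le_add (norm_sum_le_of_le _ fun k _ => hbB k) ?_)
    exact (norm_mul_le _ _).trans (by gcongr; exact hbB n)
  have hT'n : ‖T'‖ ≤ 2 * G₀ := by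
    refine ContinuousLinearMap.opNorm_le_bound _ (by positivity) fun g => ?_
    have e : G g = T' g + N' (T' g) := by
      have := congrArg (· * T') hGl
      simp only [mul_assoc, hT'r, mul_one] at this
      rw [this]
      simp
    have h1 : ‖N' (T' g)‖ ≤ 1 / 2 * ‖T' g‖ := N'.le_of_opNorm_le hN'le _
    have h2 : ‖G g‖ ≤ G₀ * ‖g‖ := G.le_of_opNorm_le hGn _
    have h3 : ‖T' g‖ ≤ ‖G g‖ + ‖N' (T' g)‖ := by
      have : T' g = G g - N' (T' g) := by rw [e]; abel
      calc ‖T' g‖ = ‖G g - N' (T' g)‖ := by rw [← this]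
        _ ≤ _ := norm_sub_le _ _
    linarith
  refine ⟨T', hT'l, hT'r, hT'n, fun f => ?_⟩
  -- Resolvent identity, with `T` on the left so that its weak continuity applies to `A - B`.
  have e : T' - T = -(T * ((A - B) * T')) := by
    have h1 : T * ((A - B) * T') = T * ((1 - B) * T') - T * (1 - A) * T' := by noncomm_ring
    rw [h1, hT'r, hTl]; noncomm_ring
  have h1 : W ((T' - T) f) = W (T ((A - B) (T' f))) := by
    rw [e, neg_apply, map_neg_eq_map]; rfl
  have h2 := hTAB (by positivity) hD'.le hTD' (T' f)
  have h3 : (δ / (4 * m * G₀) * m + D' * ε) * ‖T' f‖ ≤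
      (δ / (4 * m * G₀) * m + D' * ε) * (2 * G₀ * ‖f‖) := by
    gcongr
    exact T'.le_of_opNorm_le hT'n f
  have h4 : (δ / (4 * m * G₀) * m + D' * ε) * (2 * G₀ * ‖f‖) =
      δ / 2 * ‖f‖ + 4 * D' * G₀ * ε / 2 * ‖f‖ := by
    have e : δ / (4 * m * G₀) * m * (2 * G₀) = δ / 2 := by field_simp; norm_num
    linear_combination ‖f‖ * e
  have h5 : 4 * D' * G₀ * ε / 2 * ‖f‖ ≤ δ / 2 * ‖f‖ := by gcongr
  rw [h1]
  linarith

end Abstract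

/-! ### Exponential dichotomies: uniqueness and rescaling -/

section Dichotomy

variable {Ω : Type*} {X : Ω → Type*} [∀ ω, NormedAddCommGroup (X ω)] [∀ ω, NormedSpace ℂ (X ω)]
variable {σ : Equiv.Perm Ω}

/-- `S` has an exponential dichotomy with rates `a` (slow) and `b` (fast), where `p ω` is the
projection onto the slow space along the fast space. -/
structure Dichotomy (S : BundleEnd X σ) (a b K : ℝ) (p : ∀ ω, X ω →L[ℂ] X ω) : Prop where
  norm_le : ∀ ω, ‖p ω‖ ≤ K
  idem : ∀ ω x, p ω (p ω x) = p ω x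
  comm : ∀ ω x, p (σ ω) (S ω x) = S ω (p ω x)
  decay : ∀ ω, ∀ n : ℕ, 1 ≤ n → ∀ x, ‖cocycle S n ω (p ω x)‖ ≤ K * a ^ n * ‖x‖
  expansion : ∀ ω, ∀ n : ℕ, 1 ≤ n → ∀ x, p ω x = 0 → b ^ n * ‖x‖ ≤ K * ‖cocycle S n ω x‖
  surj : ∀ ω x, p (σ ω) x = 0 → ∃ y, p ω y = 0 ∧ S ω y = x

namespace Dichotomy

variable {S : BundleEnd X σ} {a b K a' b' K' : ℝ} {p p' : ∀ ω, X ω →L[ℂ] X ω}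

theorem mono (h : Dichotomy S a b K p) (ha : 0 ≤ a) (hK : K ≤ K') : Dichotomy S a b K' p where
  norm_le ω := (h.norm_le ω).trans hK
  idem := h.idem
  comm := h.comm
  decay ω n hn x := (h.decay ω n hn x).trans (by gcongr)
  expansion ω n hn x hx := (h.expansion ω n hn x hx).trans (by gcongr)
  surj := h.surj

theorem comm_cocycle (h : Dichotomy S a b K p) (n : ℕ) (ω : Ω) (x : X ω) :
    p (σ^[n] ω) (cocycle S n ω x) = cocycle S n ω (p ω x) := by
  induction n generalizing ω with
  | zero => rfl
  | succ n ih =>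
    change p (σ^[n] (σ ω)) (cocycle S n (σ ω) (S ω x)) = cocycle S n (σ ω) (S ω (p ω x))
    rw [ih, h.comm]

theorem surj_cocycle (h : Dichotomy S a b K p) (n : ℕ) (ω : Ω) (z : X (σ^[n] ω))
    (hz : p (σ^[n] ω) z = 0) : ∃ y, p ω y = 0 ∧ cocycle S n ω y = z := by
  induction n generalizing ω with
  | zero => exact ⟨z, hz, rfl⟩
  | succ n ih =>
    obtain ⟨y, hy, hyz⟩ := ih (σ ω) z hz
    obtain ⟨y', hy', h'⟩ := h.surj ω y hy
    refine ⟨y', hy', ?_⟩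
    change cocycle S n (σ ω) (S ω y') = z
    rw [h', hyz]

theorem norm_apply_le (h : Dichotomy S a b K p) (ω : Ω) (x : X ω) : ‖p ω x‖ ≤ K * ‖x‖ :=
  (p ω).le_of_opNorm_le (h.norm_le ω) x

theorem norm_sub_apply_le (h : Dichotomy S a b K p) (ω : Ω) (x : X ω) :
    ‖x - p ω x‖ ≤ (1 + K) * ‖x‖ :=
  (norm_sub_le _ _).trans (by have := h.norm_apply_le ω x; linarith)

theorem apply_sub_eq_zero (h : Dichotomy S a b K p) (ω : Ω) (x : X ω) : p ω (x - p ω x) = 0 := by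
  rw [map_sub, h.idem, sub_self]

theorem eq_zero_of_forall_le {Z : Type*} [NormedAddCommGroup Z] {z : Z} {C a b : ℝ} (ha : 0 ≤ a)
    (hab : a < b) (h : ∀ n : ℕ, 1 ≤ n → b ^ n * ‖z‖ ≤ C * a ^ n) : z = 0 := by
  have hb : 0 < b := ha.trans_lt hab
  by_contra hz
  have hz' : 0 < ‖z‖ := norm_pos_iff.2 hz
  obtain ⟨n, hn, hn'⟩ := exists_pow_mul_le (div_nonneg ha hb.le) ((div_lt_one hb).2 hab) C
    (half_pos hz')
  have h1 := h n hn
  have h2 : C * a ^ n = C * (a / b) ^ n * b ^ n := by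
    rw [div_pow]; field_simp
  rw [h2, mul_comm] at h1
  have h3 := le_of_mul_le_mul_right h1 (pow_pos hb n)
  linarith

/-- If the slow rate of one dichotomy is below the fast rate of another one, then the spaces of
the two dichotomies are nested. -/
theorem apply_apply_left (h : Dichotomy S a b K p) (h' : Dichotomy S a' b' K' p') (ha : 0 ≤ a)
    (hab : a < b') (hK' : 0 ≤ K') (ω : Ω) (x : X ω) : p' ω (p ω x) = p ω x := by
  -- The component of a slow vector in the other fast space would grow like b'^n, yet it is bounded
  -- by a multiple of a^n.
  refine (sub_eq_zero.1 (eq_zero_of_forall_le (C := K' * (1 + K') * K * ‖x‖) ha hab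
    fun n hn => ?_)).symm
  have h1 := h'.expansion ω n hn _ (h'.apply_sub_eq_zero ω (p ω x))
  have h2 : cocycle S n ω (p ω x - p' ω (p ω x)) =
      cocycle S n ω (p ω x) - p' _ (cocycle S n ω (p ω x)) := by
    rw [map_sub, h'.comm_cocycle]
  rw [h2] at h1
  calc _ ≤ K' * ((1 + K') * (K * a ^ n * ‖x‖)) := h1.trans (by
        gcongr
        exact (h'.norm_sub_apply_le _ _).trans (by gcongr; exact h.decay ω n hn x))
    _ = _ := by ring

/-- A fast vector for `p'` has n-step preimages of size O(b'^(-n)). Pushing their `p`-slow parts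
forward costs at most K a^n, so its own `p`-slow part is O((a/b')^n), hence zero. -/
theorem apply_apply_right (h : Dichotomy S a b K p) (h' : Dichotomy S a' b' K' p') (ha : 0 ≤ a)
    (hab : a < b') (hK : 0 ≤ K) (ω : Ω) (x : X ω) : p ω (p' ω x) = p ω x := by
  have key : p ω (x - p' ω x) = 0 := by
    refine eq_zero_of_forall_le (C := K * (K' * ‖x - p' ω x‖)) ha hab fun n hn => ?_
    obtain ⟨ω', rfl⟩ := (σ.surjective.iterate n) ω
    obtain ⟨y, hy, hyz⟩ := h'.surj_cocycle n ω' _ (h'.apply_sub_eq_zero _ x)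
    have h1 := h'.expansion ω' n hn y hy
    have h2 := h.decay ω' n hn y
    rw [← h.comm_cocycle] at h2
    rw [hyz] at h1 h2
    have hb : 0 ≤ b' ^ n := pow_nonneg (ha.trans hab.le) n
    calc _ ≤ b' ^ n * (K * a ^ n * ‖y‖) := by gcongr
      _ = K * a ^ n * (b' ^ n * ‖y‖) := by ring
      _ ≤ K * a ^ n * (K' * ‖x - p' (σ^[n] ω') x‖) := by gcongr
      _ = _ := by ring
  rw [map_sub, sub_eq_zero] at key
  exact key.symm

theorem eq_of_rates (h : Dichotomy S a b K p) (h' : Dichotomy S a' b' K' p') (ha : 0 ≤ a)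
    (ha' : 0 ≤ a') (hab' : a < b') (ha'b : a' < b) (hK : 0 ≤ K) : p = p' := by
  funext ω
  ext x
  rw [← h.apply_apply_right h' ha hab' hK, h'.apply_apply_left h ha' ha'b hK]

/-- Only one comparison of rates is available here. It nests the fast spaces, equal dimension makes
them equal, and the nesting of the slow spaces then gives equal projections. -/
theorem eq_of_finrank_eq (h : Dichotomy S a b K p) (h' : Dichotomy S a' b' K' p') (ha : 0 ≤ a)
    (hab' : a < b') (hK : 0 ≤ K) (hK' : 0 ≤ K') {d : ℕ} (ω : Ω)
    (hd : FiniteDimensional ℂ (p ω).ker ∧ Module.finrank ℂ (p ω).ker = d)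
    (hd' : FiniteDimensional ℂ (p' ω).ker ∧ Module.finrank ℂ (p' ω).ker = d) : p ω = p' ω := by
  have := hd.1
  have hle : (p' ω).ker ≤ (p ω).ker := fun x hx => by
    change p ω x = 0
    rw [← h.apply_apply_right h' ha hab' hK, show p' ω x = 0 from hx, map_zero]
  have he := Submodule.eq_of_le_of_finrank_eq hle (hd'.2.trans hd.2.symm)
  ext x
  have h1 : x - p ω x ∈ (p' ω).ker := he ▸ h.apply_sub_eq_zero ω x
  have h2 : p' ω (x - p ω x) = 0 := h1
  rw [map_sub, h.apply_apply_left h' ha hab' hK', sub_eq_zero] at h2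
  exact h2.symm

end Dichotomy

/-- The rescaled endomorphism `c⁻¹ S`. -/
def rescale (c : ℝ) (S : BundleEnd X σ) : BundleEnd X σ := fun ω => ((c⁻¹ : ℝ) : ℂ) • S ω

theorem cocycle_rescale (c : ℝ) (S : BundleEnd X σ) (n : ℕ) (ω : Ω) (x : X ω) :
    cocycle (rescale c S) n ω x = (((c⁻¹) ^ n : ℝ) : ℂ) • cocycle S n ω x := by
  induction n generalizing ω with
  | zero =>
    change x = (((c⁻¹) ^ 0 : ℝ) : ℂ) • x
    simp
  | succ n ih =>
    change cocycle (rescale c S) n (σ ω) (((c⁻¹ : ℝ) : ℂ) • S ω x) =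
      (((c⁻¹) ^ (n + 1) : ℝ) : ℂ) • cocycle S n (σ ω) (S ω x)
    rw [map_smul, ih, smul_smul, pow_succ']
    push_cast
    rfl

theorem norm_cocycle_rescale {c : ℝ} (hc : 0 < c) (S : BundleEnd X σ) (n : ℕ) (ω : Ω) (x : X ω) :
    ‖cocycle (rescale c S) n ω x‖ = (c ^ n)⁻¹ * ‖cocycle S n ω x‖ := by
  rw [cocycle_rescale, norm_smul, Complex.norm_real, Real.norm_of_nonneg (by positivity), inv_pow]

theorem Dichotomy.of_rescale {S : BundleEnd X σ} {a b K c : ℝ} {p : ∀ ω, X ω →L[ℂ] X ω}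
    (hc : 0 < c) (h : Dichotomy (rescale c S) a b K p) : Dichotomy S (c * a) (c * b) K p where
  norm_le := h.norm_le
  idem := h.idem
  comm ω x := by
    have := h.comm ω x
    simp only [rescale, smul_apply, map_smul] at this
    exact smul_right_injective _ (by simpa using hc.ne') this
  decay ω n hn x := by
    have := h.decay ω n hn x
    rw [norm_cocycle_rescale hc, inv_mul_le_iff₀ (by positivity)] at this
    exact this.trans_eq (by rw [mul_pow]; ring)
  expansion ω n hn x hx := by
    have := h.expansion ω n hn x hx
    rw [norm_cocycle_rescale hc] at this
    have h2 : c ^ n * (b ^ n * ‖x‖) ≤ c ^ n * (K * ((c ^ n)⁻¹ * ‖cocycle S n ω x‖)) := by gcongr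
    have hcn : c ^ n ≠ 0 := by positivity
    have e : c ^ n * (K * ((c ^ n)⁻¹ * ‖cocycle S n ω x‖)) = K * ‖cocycle S n ω x‖ := by field_simp
    rw [e] at h2
    rwa [mul_pow, mul_assoc]
  surj ω x hx := by
    obtain ⟨y, hy, h'⟩ := h.surj ω (((c⁻¹ : ℝ) : ℂ) • x) (by rw [map_smul, hx, smul_zero])
    exact ⟨y, hy, smul_right_injective _ (by simpa using hc.ne') h'⟩

theorem Dichotomy.to_rescale {S : BundleEnd X σ} {a b K c : ℝ} {p : ∀ ω, X ω →L[ℂ] X ω}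
    (hc : 0 < c) (h : Dichotomy S a b K p) :
    Dichotomy (rescale c S) (a / c) (b / c) K p := by
  have e : rescale c⁻¹ (rescale c S) = S := by
    funext ω
    ext x
    simp [rescale, hc.ne']
  have h1 : Dichotomy (rescale c⁻¹ (rescale c S)) a b K p := by rwa [e]
  simpa [div_eq_inv_mul] using h1.of_rescale (inv_pos.2 hc)

theorem rescale_mem_lasotaYorke {w : ∀ ω, Seminorm ℂ (X ω)} {S : BundleEnd X σ}
    {C₁ C₂ r R c : ℝ} (hc : 0 < c) (h : S ∈ lasotaYorke w σ C₁ C₂ r R) :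
    rescale c S ∈ lasotaYorke w σ C₁ C₂ (r / c) (R / c) := by
  intro ω f n hn
  rw [norm_cocycle_rescale hc, div_pow, div_pow]
  have h1 := h ω f n hn
  calc _ ≤ (c ^ n)⁻¹ * (C₁ * r ^ n * ‖f‖ + C₂ * R ^ n * w ω f) := by gcongr
    _ = _ := by ring

/-- On the fast spaces the weak norm dominates the strong norm. -/
theorem exists_norm_le_of_lasotaYorke {C₁ C₂ r R b K : ℝ} (hC₂ : 0 ≤ C₂) (hr : 0 ≤ r)
    (hrb : r < b) (hR : 0 ≤ R) (hK : 0 ≤ K) :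
    ∃ c > 0, ∀ (w : ∀ ω, Seminorm ℂ (X ω)) (S : BundleEnd X σ) (p : ∀ ω, X ω →L[ℂ] X ω) (a : ℝ),
      S ∈ lasotaYorke w σ C₁ C₂ r R → Dichotomy S a b K p →
      ∀ ω x, p ω x = 0 → ‖x‖ ≤ c * w ω x := by
  have hb : 0 < b := hr.trans_lt hrb
  -- Expansion against Lasota-Yorke: b^n ‖x‖ ≤ K C₁ r^n ‖x‖ + K C₂ R^n w x, and n is large enough
  -- for the first term to be absorbed on the left.
  obtain ⟨n, hn, hn'⟩ := exists_pow_mul_le (div_nonneg hr hb.le) ((div_lt_one hb).2 hrb) (K * C₁)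
    (show (0 : ℝ) < 1 / 2 by norm_num)
  have h2 : K * C₁ * r ^ n ≤ b ^ n / 2 := by
    rw [div_pow, ← mul_div_assoc, div_le_iff₀ (by positivity)] at hn'
    linarith
  refine ⟨2 * (K * (C₂ * R ^ n)) / b ^ n + 1, by positivity, fun w S p a hS h ω x hx => ?_⟩
  have h1 := (h.expansion ω n hn x hx).trans (mul_le_mul_of_nonneg_left (hS ω x n hn) hK)
  have h3 : K * C₁ * r ^ n * ‖x‖ ≤ b ^ n / 2 * ‖x‖ := by gcongr
  have h4 : b ^ n * ‖x‖ ≤ 2 * (K * (C₂ * R ^ n)) * w ω x := by linarith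
  have h5 : ‖x‖ ≤ 2 * (K * (C₂ * R ^ n)) * w ω x / b ^ n := by
    rw [le_div_iff₀ (by positivity)]; linarith
  have h6 := apply_nonneg (w ω) x
  calc ‖x‖ ≤ 2 * (K * (C₂ * R ^ n)) * w ω x / b ^ n := h5
    _ ≤ 2 * (K * (C₂ * R ^ n)) * w ω x / b ^ n + w ω x := by linarith
    _ = _ := by ring

end Dichotomy

/-! ### Bounded sections and invertibility from a dichotomy -/

section Sections

variable {Ω : Type*} {X : Ω → Type*} [∀ ω, NormedAddCommGroup (X ω)] [∀ ω, NormedSpace ℂ (X ω)]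
variable {σ : Equiv.Perm Ω}

omit [∀ ω, NormedSpace ℂ (X ω)] in
theorem exists_section {f : ∀ ω, X ω} {C : ℝ} (hf : ∀ ω, ‖f ω‖ ≤ C) :
    ∃ g : lp X ∞, ∀ ω, g ω = f ω :=
  ⟨⟨f, memℓp_infty ⟨C, by rintro _ ⟨ω, rfl⟩; exact hf ω⟩⟩, fun _ => rfl⟩

/-- A uniformly bounded family of linear maps `X (τ ω) → X ω` acts on bounded sections. -/
theorem exists_operator_of_bounded {τ : Ω → Ω} (b : ∀ ω, X (τ ω) →L[ℂ] X ω) {C : ℝ} (hC : 0 ≤ C)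
    (hb : ∀ ω, ‖b ω‖ ≤ C) :
    ∃ B : lp X ∞ →L[ℂ] lp X ∞, ∀ f ω, B f ω = b ω (f (τ ω)) := by
  have hbf (f : lp X ∞) (ω : Ω) : ‖b ω (f (τ ω))‖ ≤ C * ‖f‖ :=
    ((b ω).le_of_opNorm_le (hb ω) _).trans
      (by gcongr; exact lp.norm_apply_le_norm ENNReal.top_ne_zero f _)
  choose g hg using fun f : lp X ∞ => exists_section (hbf f)
  refine ⟨LinearMap.mkContinuous
    { toFun := g
      map_add' := fun f f' => ?_
      map_smul' := fun c f => ?_ } C fun f => ?_, fun f ω => hg f ω⟩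
  · ext ω
    simp [hg]
  · ext ω
    simp [hg]
  · exact lp.norm_le_of_forall_le (by positivity) fun ω => by
      change ‖g f ω‖ ≤ _
      rw [hg]
      exact hbf f ω

/-- `A` is the operator induced by `S` on bounded sections. -/
def IsSectionOperator (S : BundleEnd X σ) (A : lp X ∞ →L[ℂ] lp X ∞) : Prop :=
  ∀ f ω, A f (σ ω) = S ω (f ω)

theorem exists_isSectionOperator (S : BundleEnd X σ) {C : ℝ} (hC : 0 ≤ C)
    (hS : ∀ ω, ‖S ω‖ ≤ C) : ∃ A, IsSectionOperator S A := by
  -- The fibre over σ (σ⁻¹ ω) equals `X ω` only propositionally; `HEq` carries the map across.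
  have key : ∀ ω, ∃ b : X (σ.symm ω) →L[ℂ] X ω, ‖b‖ ≤ C ∧
      ∀ f : ∀ ω, X ω, ∀ ω', σ ω' = ω → HEq (b (f (σ.symm ω))) (S ω' (f ω')) := by
    intro ω
    obtain ⟨ω', rfl⟩ := σ.surjective ω
    have h : σ.symm (σ ω') = ω' := σ.symm_apply_apply ω'
    have : ∃ b : X ω' →L[ℂ] X (σ ω'), ‖b‖ ≤ C ∧
      ∀ f : ∀ ω, X ω, ∀ ω'', σ ω'' = σ ω' → HEq (b (f ω')) (S ω'' (f ω'')) := by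
      refine ⟨S ω', hS ω', fun f ω'' h => ?_⟩
      obtain rfl := σ.injective h
      rfl
    rwa [h]
  choose b hb hb' using key
  obtain ⟨A, hA⟩ := exists_operator_of_bounded b hC hb
  exact ⟨A, fun f ω => by rw [hA]; exact eq_of_heq (hb' _ f ω rfl)⟩

namespace IsSectionOperator

variable {S : BundleEnd X σ} {A : lp X ∞ →L[ℂ] lp X ∞}

theorem pow_apply (h : IsSectionOperator S A) (n : ℕ) (f : lp X ∞) (ω : Ω) :
    (A ^ n) f (σ^[n] ω) = cocycle S n ω (f ω) := by
  induction n generalizing f ω with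
  | zero => rfl
  | succ n ih =>
    rw [pow_succ]
    change (A ^ n) (A f) (σ^[n] (σ ω)) = cocycle S n (σ ω) (S ω (f ω))
    rw [ih, h]

end IsSectionOperator

omit [∀ ω, NormedSpace ℂ (X ω)] in
theorem norm_apply_le_norm_section (f : lp X ∞) (ω : Ω) : ‖f ω‖ ≤ ‖f‖ :=
  lp.norm_apply_le_norm ENNReal.top_ne_zero f ω

omit [∀ ω, NormedSpace ℂ (X ω)] in
theorem norm_section_le {f : lp X ∞} {C : ℝ} (hC : 0 ≤ C) {n : ℕ}
    (h : ∀ ω, ‖f (σ^[n] ω)‖ ≤ C) : ‖f‖ ≤ C :=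
  lp.norm_le_of_forall_le hC fun ω => by
    obtain ⟨ω', rfl⟩ := (σ.surjective.iterate n) ω
    exact h ω'

section Weak

variable {w : ∀ ω, Seminorm ℂ (X ω)}

theorem bddAbove_weak (hw : ∀ ω x, w ω x ≤ ‖x‖) (f : lp X ∞) :
    BddAbove (Set.range fun ω => w ω (f ω)) :=
  ⟨‖f‖, by rintro _ ⟨ω, rfl⟩; exact (hw ω _).trans (norm_apply_le_norm_section f ω)⟩

/-- The supremum over the base of the weak norms of a bounded section. -/
def supSeminorm (w : ∀ ω, Seminorm ℂ (X ω)) (hw : ∀ ω x, w ω x ≤ ‖x‖) : Seminorm ℂ (lp X ∞) :=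
  Seminorm.of (fun f => ⨆ ω, w ω (f ω))
    (fun f g => Real.iSup_le
      (fun ω => (map_add_le_add (w ω) (f ω) (g ω)).trans
        (add_le_add (le_ciSup (bddAbove_weak hw f) ω) (le_ciSup (bddAbove_weak hw g) ω)))
      (add_nonneg (Real.iSup_nonneg fun ω => apply_nonneg _ _)
        (Real.iSup_nonneg fun ω => apply_nonneg _ _)))
    (fun c f => by
      rw [Real.mul_iSup_of_nonneg (norm_nonneg c)]
      congr 1
      funext ω
      exact map_smul_eq_mul (w ω) c (f ω))

variable (hw : ∀ ω x, w ω x ≤ ‖x‖)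

theorem le_supSeminorm (f : lp X ∞) (ω : Ω) : w ω (f ω) ≤ supSeminorm w hw f :=
  le_ciSup (bddAbove_weak hw f) ω

theorem supSeminorm_le {f : lp X ∞} {C : ℝ} (hC : 0 ≤ C) (h : ∀ ω, w ω (f ω) ≤ C) :
    supSeminorm w hw f ≤ C :=
  Real.iSup_le h hC

theorem supSeminorm_le_of_shift {f : lp X ∞} {C : ℝ} (hC : 0 ≤ C)
    (h : ∀ ω, w (σ ω) (f (σ ω)) ≤ C) : supSeminorm w hw f ≤ C :=
  supSeminorm_le hw hC fun ω => by
    obtain ⟨ω', rfl⟩ := σ.surjective ω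
    exact h ω'

theorem supSeminorm_le_norm (f : lp X ∞) : supSeminorm w hw f ≤ ‖f‖ :=
  supSeminorm_le hw (norm_nonneg f) fun ω => (hw ω _).trans (norm_apply_le_norm_section f ω)

theorem IsSectionOperator.lasotaYorkeBound {S : BundleEnd X σ} {A : lp X ∞ →L[ℂ] lp X ∞}
    (h : IsSectionOperator S A) {C₁ C₂ r R : ℝ} (hC₁ : 0 ≤ C₁) (hC₂ : 0 ≤ C₂) (hr : 0 ≤ r)
    (hR : 0 ≤ R) (hS : S ∈ lasotaYorke w σ C₁ C₂ r R) :
    LasotaYorkeBound (supSeminorm w hw) C₁ C₂ r R A := by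
  intro n hn f
  refine norm_section_le (σ := σ) (n := n) (by positivity) fun ω => ?_
  rw [h.pow_apply]
  refine (hS ω (f ω) n hn).trans ?_
  gcongr
  · exact norm_apply_le_norm_section f ω
  · exact le_supSeminorm hw f ω

theorem IsSectionOperator.weaklyContinuous {S : BundleEnd X σ} {A : lp X ∞ →L[ℂ] lp X ∞}
    (h : IsSectionOperator S A)
    (hS : ∀ η > 0, ∃ C > 0, ∀ ω, ∀ f : X ω, w (σ ω) (S ω f) ≤ η * ‖f‖ + C * w ω f) :
    WeaklyContinuous (supSeminorm w hw) A := by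
  intro η hη
  obtain ⟨C, hC, hSC⟩ := hS η hη
  refine ⟨C, hC, fun f => supSeminorm_le_of_shift (σ := σ) hw (by positivity) fun ω => ?_⟩
  rw [h]
  refine (hSC ω (f ω)).trans ?_
  gcongr
  · exact norm_apply_le_norm_section f ω
  · exact le_supSeminorm hw f ω

theorem IsSectionOperator.supSeminorm_sub_le {S S' : BundleEnd X σ} {A A' : lp X ∞ →L[ℂ] lp X ∞}
    (h : IsSectionOperator S A) (h' : IsSectionOperator S' A') {ε : ℝ} (hε : 0 ≤ ε)
    (hSS' : ∀ ω f, w (σ ω) (S ω f - S' ω f) ≤ ε * ‖f‖) (f : lp X ∞) :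
    supSeminorm w hw ((A - A') f) ≤ ε * ‖f‖ := by
  refine supSeminorm_le_of_shift (σ := σ) hw (by positivity) fun ω => ?_
  have e : (A - A') f (σ ω) = S ω (f ω) - S' ω (f ω) := by rw [← h, ← h']; rfl
  rw [e]
  exact (hSS' ω (f ω)).trans (by gcongr; exact norm_apply_le_norm_section f ω)

end Weak

/-- On the slow part `1 - A` is `1 - A * P`. On the fast part `B` inverts `A`, and (1 - A) B = -(1 -
P)(1 - B). This gives the inverse P (1 - A P)⁻¹ - B (1 - B)⁻¹. -/
theorem isUnit_one_sub_of_splitting {M : Type*} [Ring M] {A B P : M} (hP : P * P = P)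
    (hAP : A * P = P * A) (hAB : A * B = 1 - P) (hBA : B * A = 1 - P) (hPB : P * B = 0)
    (hBP : B * P = 0) (h₁ : IsUnit (1 - A * P)) (h₂ : IsUnit (1 - B)) : IsUnit (1 - A) := by
  obtain ⟨u, hu⟩ := h₁
  obtain ⟨v, hv⟩ := h₂
  have hr : (1 - A) * (P * ↑u⁻¹ - B * ↑v⁻¹) = 1 := by
    have e1 : (1 - A) * P = P * u := by
      rw [hu, mul_sub, sub_mul, ← mul_assoc P A P, ← hAP, mul_assoc A P P, hP]; simp
    have e2 : (1 - A) * B = -((1 - P) * v) := by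
      rw [hv, mul_sub, mul_one, sub_mul 1 P B, hPB, sub_mul, hAB]; simp
    rw [mul_sub, ← mul_assoc, e1, ← mul_assoc, e2]
    simp [mul_assoc]
  have hl : (↑u⁻¹ * P - ↑v⁻¹ * B) * (1 - A) = 1 := by
    have e1 : P * (1 - A) = u * P := by
      rw [hu, mul_sub, sub_mul, mul_assoc A P P, hP, hAP]; simp
    have e2 : B * (1 - A) = -(v * (1 - P)) := by
      rw [hv, sub_mul, one_mul, mul_sub B 1 P, hBP, mul_sub, hBA]; simp
    rw [sub_mul, mul_assoc, e1, mul_assoc, e2]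
    simp [← mul_assoc]
  exact ⟨⟨1 - A, _, hr, by rwa [← left_inv_eq_right_inv hl hr]⟩, rfl⟩

/-- Dichotomy constants may exceed 1, so only a high power is a contraction; the geometric sum links
1 - a^n to 1 - a. -/
theorem isUnit_one_sub_of_norm_pow_lt_one {M : Type*} [NormedRing M] [CompleteSpace M] {a : M}
    {n : ℕ} (h : ‖a ^ n‖ < 1) : IsUnit (1 - a) := by
  have hu := isUnit_one_sub_of_norm_lt_one h
  exact isUnit_of_mul_isUnit_of_isUnit_mul (g := ∑ k ∈ Finset.range n, a ^ k)
    (by rwa [mul_neg_geom_sum]) (by rwa [geom_sum_mul_neg])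

namespace Dichotomy

variable {S : BundleEnd X σ} {a b K : ℝ} {p : ∀ ω, X ω →L[ℂ] X ω}

theorem eq_of_apply_eq (h : Dichotomy S a b K p) (hb : 0 < b) {ω : Ω} {x y : X ω}
    (hx : p ω x = 0) (hy : p ω y = 0) (hxy : S ω x = S ω y) : x = y := by
  have h1 := h.expansion ω 1 le_rfl (x - y) (by rw [map_sub, hx, hy, sub_zero])
  have h2 : cocycle S 1 ω (x - y) = 0 := by
    change S ω (x - y) = 0
    rw [map_sub, hxy, sub_self]
  rw [h2, norm_zero, mul_zero, pow_one] at h1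
  exact sub_eq_zero.1 (norm_le_zero_iff.1 (nonpos_of_mul_nonpos_right h1 hb))

/-- The inverse of `S` on the fast spaces, extended by zero to the slow spaces. -/
theorem exists_fastInverse (h : Dichotomy S a b K p) (hb : 0 < b) (hK : 0 ≤ K) :
    ∃ B : ∀ ω, X (σ ω) →L[ℂ] X ω, (∀ ω, ‖B ω‖ ≤ K * (1 + K) / b) ∧ (∀ ω x, p ω (B ω x) = 0) ∧
      ∀ ω x, S ω (B ω x) = x - p (σ ω) x := by
  choose g hg hg' using fun ω (x : X (σ ω)) => h.surj ω _ (h.apply_sub_eq_zero (σ ω) x)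
  refine ⟨fun ω => LinearMap.mkContinuous
    { toFun := g ω
      map_add' := fun x y => h.eq_of_apply_eq hb (hg _ _) (by rw [map_add, hg, hg, add_zero]) ?_
      map_smul' := fun c x => h.eq_of_apply_eq hb (hg _ _) (by simp [hg]) ?_ }
    (K * (1 + K) / b) fun x => ?_, fun ω => ?_, fun ω x => hg ω x, fun ω x => hg' ω x⟩
  · rw [map_add, hg', hg', hg', map_add]; abel
  · simp [hg', smul_sub]
  · have h1 := h.expansion ω 1 le_rfl _ (hg ω x)
    have h2 : cocycle S 1 ω (g ω x) = x - p (σ ω) x := hg' ω x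
    rw [h2, pow_one] at h1
    have h3 := h.norm_sub_apply_le (σ ω) x
    have h4 : b * ‖g ω x‖ ≤ K * ((1 + K) * ‖x‖) := h1.trans (mul_le_mul_of_nonneg_left h3 hK)
    change ‖g ω x‖ ≤ _
    rw [div_mul_eq_mul_div, le_div_iff₀ hb]
    linarith
  · exact LinearMap.mkContinuous_norm_le _ (by positivity) _

theorem isUnit_one_sub [∀ ω, CompleteSpace (X ω)] (h : Dichotomy S a b K p) (ha : 0 ≤ a)
    (ha1 : a < 1) (hb1 : 1 < b) (hK : 0 ≤ K) {A : lp X ∞ →L[ℂ] lp X ∞}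
    (hA : IsSectionOperator S A) : IsUnit (1 - A) := by
  have hb : 0 < b := one_pos.trans hb1
  obtain ⟨g, hgn, hpg, hSg⟩ := h.exists_fastInverse hb hK
  obtain ⟨P, hP⟩ := exists_operator_of_bounded (τ := id) p hK h.norm_le
  obtain ⟨B, hB⟩ := exists_operator_of_bounded g (by positivity) hgn
  have hPf (f : lp X ∞) (ω : Ω) : P f ω = p ω (f ω) := hP f ω
  have hext {M N : lp X ∞ →L[ℂ] lp X ∞} (H : ∀ f ω, M f (σ ω) = N f (σ ω)) : M = N := by
    ext f ω
    obtain ⟨ω', rfl⟩ := σ.surjective ω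
    exact H f ω'
  have hPP : P * P = P := by
    ext f ω
    change P (P f) ω = P f ω
    rw [hPf, hPf, h.idem]
  have hAP : A * P = P * A := hext fun f ω => by
    change A (P f) (σ ω) = P (A f) (σ ω)
    rw [hA, hPf, hPf, hA, h.comm]
  have hAB : A * B = 1 - P := hext fun f ω => by
    change A (B f) (σ ω) = f (σ ω) - P f (σ ω)
    rw [hA, hB, hSg, hPf]
  have hPB : P * B = 0 := by
    ext f ω
    change P (B f) ω = 0
    rw [hPf, hB, hpg]
  have hBA : B * A = 1 - P := by
    ext f ω
    change B (A f) ω = f ω - P f ω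
    rw [hB, hA, hPf]
    refine h.eq_of_apply_eq hb (hpg _ _) (h.apply_sub_eq_zero _ _) ?_
    rw [hSg, h.comm, map_sub]
  have hBP : B * P = 0 := by
    ext f ω
    change B (P f) ω = 0
    rw [hB, hPf]
    refine h.eq_of_apply_eq hb (hpg _ _) (map_zero _) ?_
    rw [hSg, h.idem, sub_self, map_zero]
  refine isUnit_one_sub_of_splitting hPP hAP hAB hBA hPB hBP ?_ ?_
  · obtain ⟨n, hn, hn'⟩ := exists_pow_mul_le ha ha1 K (show (0 : ℝ) < 1 / 2 by norm_num)
    refine isUnit_one_sub_of_norm_pow_lt_one (n := n) (lt_of_le_of_lt ?_ one_half_lt_one)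
    have e : (A * P) ^ n = A ^ n * P := by
      rw [Commute.mul_pow hAP]
      obtain ⟨m, rfl⟩ := Nat.exists_eq_add_of_le' hn
      rw [IsIdempotentElem.pow_succ_eq m hPP]
    rw [e]
    refine ContinuousLinearMap.opNorm_le_bound _ (by norm_num) fun f =>
      norm_section_le (σ := σ) (n := n) (by positivity) fun ω => ?_
    change ‖(A ^ n) (P f) (σ^[n] ω)‖ ≤ _
    rw [hA.pow_apply, hPf]
    refine (h.decay ω n hn _).trans ?_
    gcongr
    exact norm_apply_le_norm_section f ω
  · obtain ⟨n, hn, hn'⟩ := exists_pow_mul_le (inv_nonneg.2 hb.le) (inv_lt_one_of_one_lt₀ hb1)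
      (K * ‖1 - P‖) (show (0 : ℝ) < 1 / 2 by norm_num)
    refine isUnit_one_sub_of_norm_pow_lt_one (n := n) (lt_of_le_of_lt ?_ one_half_lt_one)
    -- B^n f lies in the fast space because n ≥ 1, and A^n B^n = 1 - P. Expansion therefore gives
    -- b^n ‖B^n f‖ ≤ K ‖1 - P‖ ‖f‖.
    have hQB : (1 - P) * B = B := by rw [sub_mul, one_mul, hPB, sub_zero]
    have e (m : ℕ) : A ^ (m + 1) * B ^ (m + 1) = 1 - P := by
      induction m with
      | zero => simpa using hAB
      | succ m ih =>
        calc A ^ (m + 1 + 1) * B ^ (m + 1 + 1) = A ^ (m + 1) * (A * B * B) * B ^ m := by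
              rw [pow_succ A, pow_succ' B, pow_succ' B]; simp only [mul_assoc]
          _ = A ^ (m + 1) * B ^ (m + 1) := by rw [hAB, hQB, pow_succ' B, mul_assoc]
          _ = 1 - P := ih
    refine ContinuousLinearMap.opNorm_le_bound _ (by norm_num) fun f =>
      lp.norm_le_of_forall_le (by positivity) fun ω => ?_
    obtain ⟨m, rfl⟩ := Nat.exists_eq_add_of_le' hn
    have h0 : p ω ((B ^ (m + 1)) f ω) = 0 := by
      rw [pow_succ']
      change p ω (B ((B ^ m) f) ω) = 0
      rw [hB, hpg]
    have h1 := h.expansion ω (m + 1) hn _ h0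
    rw [← hA.pow_apply] at h1
    have h2 : (A ^ (m + 1)) ((B ^ (m + 1)) f) = (1 - P) f :=
      congrArg (fun M : lp X ∞ →L[ℂ] lp X ∞ => M f) (e m)
    rw [h2] at h1
    have h3 : ‖(1 - P) f (σ^[m + 1] ω)‖ ≤ ‖1 - P‖ * ‖f‖ :=
      (norm_apply_le_norm_section _ _).trans ((1 - P).le_opNorm f)
    have h4 : b ^ (m + 1) * ‖(B ^ (m + 1)) f ω‖ ≤ K * (‖1 - P‖ * ‖f‖) := h1.trans (by gcongr)
    calc ‖(B ^ (m + 1)) f ω‖ = b⁻¹ ^ (m + 1) * (b ^ (m + 1) * ‖(B ^ (m + 1)) f ω‖) := by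
          rw [← mul_assoc, ← mul_pow, inv_mul_cancel₀ hb.ne', one_pow, one_mul]
      _ ≤ b⁻¹ ^ (m + 1) * (K * (‖1 - P‖ * ‖f‖)) := by gcongr
      _ = K * ‖1 - P‖ * b⁻¹ ^ (m + 1) * ‖f‖ := by ring
      _ ≤ 1 / 2 * ‖f‖ := by gcongr

end Dichotomy

end Sections

/-! ### Green operators: a dichotomy from invertibility -/

section Green

variable {Ω : Type*} {X : Ω → Type*} [∀ ω, NormedAddCommGroup (X ω)] [∀ ω, NormedSpace ℂ (X ω)]
variable {σ : Equiv.Perm Ω}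

open Classical in
/-- The section supported at the single point `ω`. -/
def delta (ω : Ω) (x : X ω) : lp X ∞ := lp.single ∞ ω x

omit [∀ ω, NormedSpace ℂ (X ω)] in
open Classical in
theorem delta_self (ω : Ω) (x : X ω) : delta ω x ω = x := lp.single_apply_self ∞ ω x

omit [∀ ω, NormedSpace ℂ (X ω)] in
open Classical in
theorem delta_of_ne {ω ω' : Ω} (x : X ω) (h : ω' ≠ ω) : delta ω x ω' = 0 :=
  lp.single_apply_ne ∞ ω x h

omit [∀ ω, NormedSpace ℂ (X ω)] in
open Classical in
theorem norm_delta (ω : Ω) (x : X ω) : ‖delta ω x‖ = ‖x‖ := lp.norm_single ENNReal.zero_lt_top ω x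

open Classical in
/-- The diagonal blocks of an operator on bounded sections. -/
def diagonal (T : lp X ∞ →L[ℂ] lp X ∞) (ω : Ω) : X ω →L[ℂ] X ω :=
  LinearMap.mkContinuous
    { toFun := fun x => T (delta ω x) ω
      map_add' := fun x y => by
        rw [delta, lp.single_add, map_add]; rfl
      map_smul' := fun c x => by
        rw [delta, lp.single_smul, map_smul]; rfl }
    ‖T‖ fun x => (norm_apply_le_norm_section _ _).trans
      ((T.le_opNorm _).trans_eq (by rw [norm_delta]))

theorem diagonal_apply (T : lp X ∞ →L[ℂ] lp X ∞) (ω : Ω) (x : X ω) :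
    diagonal T ω x = T (delta ω x) ω := rfl

theorem norm_diagonal_le (T : lp X ∞ →L[ℂ] lp X ∞) (ω : Ω) : ‖diagonal T ω‖ ≤ ‖T‖ :=
  LinearMap.mkContinuous_norm_le _ (norm_nonneg T) _

namespace IsSectionOperator

variable {S : BundleEnd X σ} {A : lp X ∞ →L[ℂ] lp X ∞}

theorem apply_delta (h : IsSectionOperator S A) (ω : Ω) (x : X ω) :
    A (delta ω x) = delta (σ ω) (S ω x) := by
  ext ω'
  obtain ⟨ω', rfl⟩ := σ.surjective ω'
  rw [h]
  by_cases e : ω' = ω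
  · subst e
    rw [delta_self, delta_self]
  · rw [delta_of_ne _ e, delta_of_ne _ (fun e' => e (σ.injective e')), map_zero]

theorem pow_apply_delta (h : IsSectionOperator S A) (n : ℕ) (ω : Ω) (x : X ω) :
    (A ^ n) (delta ω x) = delta (σ^[n] ω) (cocycle S n ω x) := by
  induction n generalizing ω with
  | zero => rfl
  | succ n ih =>
    rw [pow_succ]
    change (A ^ n) (A (delta ω x)) = delta (σ^[n] (σ ω)) (cocycle S n (σ ω) (S ω x))
    rw [h.apply_delta, ih]

variable {T : lp X ∞ →L[ℂ] lp X ∞}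

/-- A solution of `f - A f = δ_ω` is an orbit of the cocycle away from `ω`. -/
theorem cocycle_apply_of_sub_eq_delta (h : IsSectionOperator S A) {ω : Ω} {x : X ω} {f : lp X ∞}
    (hf : f - A f = delta ω x) (n : ℕ) (ω' : Ω)
    (hω : ∀ k : ℕ, 1 ≤ k → k ≤ n → σ^[k] ω' ≠ ω) : cocycle S n ω' (f ω') = f (σ^[n] ω') := by
  induction n generalizing ω' with
  | zero => rfl
  | succ n ih =>
    change cocycle S n (σ ω') (S ω' (f ω')) = f (σ^[n] (σ ω'))
    have h1 : f (σ ω') - A f (σ ω') = 0 := by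
      have := congrArg (fun g : lp X ∞ => g (σ ω')) hf
      exact this.trans (delta_of_ne x (hω 1 le_rfl (by omega)))
    rw [← h, ← sub_eq_zero.1 h1]
    exact ih (σ ω') fun k hk hkn => hω (k + 1) (by omega) (by omega)

theorem sub_apply_delta (hTr : (1 - A) * T = 1) (ω : Ω) (x : X ω) :
    T (delta ω x) - A (T (delta ω x)) = delta ω x :=
  congrArg (fun M : lp X ∞ →L[ℂ] lp X ∞ => M (delta ω x)) hTr

theorem apply_sub_apply (hTl : T * (1 - A) = 1) (f : lp X ∞) : T f - T (A f) = f := by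
  rw [← map_sub]
  exact congrArg (fun M : lp X ∞ →L[ℂ] lp X ∞ => M f) hTl

/-- Truncate f = T δ_ω(x) to the forward orbit of ω. By aperiodicity σ⁻¹ ω is not on that orbit, so
the truncation g solves g - A g = δ_ω(f ω). Hence T δ_ω(f ω) = g, whose value at ω is again f ω. -/
theorem diagonal_idem (h : IsSectionOperator S A) (haper : ∀ ω, ∀ n : ℕ, 1 ≤ n → σ^[n] ω ≠ ω)
    (hTl : T * (1 - A) = 1) (hTr : (1 - A) * T = 1) (ω : Ω) (x : X ω) :
    diagonal T ω (diagonal T ω x) = diagonal T ω x := by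
  classical
  set f := T (delta ω x) with hf
  have hfA : f - A f = delta ω x := sub_apply_delta hTr ω x
  obtain ⟨g, hg⟩ := exists_section (f := fun ω' => if ∃ n : ℕ, σ^[n] ω = ω' then f ω' else 0)
    (C := ‖f‖) fun ω' => by
      split_ifs
      · exact norm_apply_le_norm_section f ω'
      · simp
  have hgω : g ω = f ω := by rw [hg, if_pos ⟨0, rfl⟩]
  have hgA : g - A g = delta ω (f ω) := by
    ext ω'
    obtain ⟨ω', rfl⟩ := σ.surjective ω'
    change g (σ ω') - A g (σ ω') = _
    rw [h]
    by_cases e : ∃ n : ℕ, σ^[n] ω = ω'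
    · obtain ⟨n, rfl⟩ := e
      have e' : σ (σ^[n] ω) = σ^[n + 1] ω := (Function.iterate_succ_apply' σ n ω).symm
      have hne : σ (σ^[n] ω) ≠ ω := e' ▸ haper ω (n + 1) (by omega)
      rw [hg, hg, if_pos ⟨n + 1, e'.symm⟩, if_pos ⟨n, rfl⟩, delta_of_ne _ hne, ← h]
      have := congrArg (fun g : lp X ∞ => g (σ (σ^[n] ω))) hfA
      exact this.trans (delta_of_ne x hne)
    · rw [hg ω', if_neg e, map_zero, sub_zero]
      by_cases e' : σ ω' = ω
      · subst e'
        rw [delta_self, hgω]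
      · rw [delta_of_ne _ e', hg, if_neg]
        rintro ⟨n, hn⟩
        rcases n with _ | n
        · exact e' hn.symm
        · rw [Function.iterate_succ_apply'] at hn
          exact e ⟨n, σ.injective hn⟩
  have h1 : T (delta ω (f ω)) = g := by
    rw [← hgA, map_sub]
    exact apply_sub_apply hTl g
  rw [diagonal_apply, diagonal_apply, ← hf, h1, hgω]

/-- If `1 - A` is invertible on bounded sections over an aperiodic base, the diagonal of the
inverse consists of the projections of an exponential dichotomy. -/
theorem dichotomy (h : IsSectionOperator S A) (haper : ∀ ω, ∀ n : ℕ, 1 ≤ n → σ^[n] ω ≠ ω)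
    (hTl : T * (1 - A) = 1) (hTr : (1 - A) * T = 1) :
    Dichotomy S 1 1 ‖T‖ (diagonal T) where
  norm_le := norm_diagonal_le T
  idem := h.diagonal_idem haper hTl hTr
  comm ω x := by
    rw [diagonal_apply, diagonal_apply, ← h.apply_delta, ← h]
    have h1 := apply_sub_apply hTl (delta ω x)
    have h2 := sub_apply_delta hTr ω x
    rw [sub_right_inj.1 (h1.trans h2.symm)]
  decay ω n hn x := by
    rw [one_pow, mul_one, diagonal_apply,
      h.cocycle_apply_of_sub_eq_delta (sub_apply_delta hTr ω x) n ω fun k hk _ => haper ω k hk]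
    exact (norm_apply_le_norm_section _ _).trans ((T.le_opNorm _).trans_eq (by rw [norm_delta]))
  expansion ω n hn x hx := by
    rw [one_pow, one_mul]
    -- Telescoping T g - T (A g) = g, where A^(m+1) δ_ω(x) vanishes at ω by aperiodicity: x can be
    -- read off from T applied to S^n x placed at σ^n ω.
    have key (m : ℕ) : T ((A ^ (m + 1)) (delta ω x)) ω = -x := by
      induction m with
      | zero =>
        have h1 := congrArg (fun g : lp X ∞ => g ω) (apply_sub_apply hTl (delta ω x))
        have h2 : T (delta ω x) ω - T (A (delta ω x)) ω = x := h1.trans (delta_self ω x)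
        rw [← diagonal_apply, hx, zero_sub] at h2
        rw [zero_add, pow_one]
        exact neg_eq_iff_eq_neg.1 h2
      | succ m ih =>
        have h1 := congrArg (fun g : lp X ∞ => g ω)
          (apply_sub_apply hTl ((A ^ (m + 1)) (delta ω x)))
        have h2 : T ((A ^ (m + 1)) (delta ω x)) ω - T (A ((A ^ (m + 1)) (delta ω x))) ω = 0 := by
          refine h1.trans ?_
          rw [h.pow_apply_delta]
          exact delta_of_ne _ (haper ω (m + 1) (by omega)).symm
        rw [pow_succ' A (m + 1)]
        change T (A ((A ^ (m + 1)) (delta ω x))) ω = -x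
        rw [← sub_eq_zero.1 h2, ih]
    obtain ⟨m, rfl⟩ := Nat.exists_eq_add_of_le' hn
    rw [← norm_neg x, ← key m, h.pow_apply_delta]
    exact (norm_apply_le_norm_section _ _).trans ((T.le_opNorm _).trans_eq (by rw [norm_delta]))
  surj ω x hx := by
    -- As f vanishes at σ ω, the equation there reads -S (f ω) = x. That -f ω is fast follows from T
    -- δ_ω - T A δ_ω = δ_ω evaluated at ω.
    set f := T (delta (σ ω) x) with hf
    have hfA : f - A f = delta (σ ω) x := sub_apply_delta hTr (σ ω) x
    have hS : S ω (-f ω) = x := by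
      have h1 := congrArg (fun g : lp X ∞ => g (σ ω)) hfA
      have h2 : f (σ ω) - A f (σ ω) = x := h1.trans (delta_self (σ ω) x)
      rw [show f (σ ω) = 0 from hx, zero_sub, h] at h2
      rw [map_neg, h2]
    refine ⟨-f ω, ?_, hS⟩
    have h1 := congrArg (fun g : lp X ∞ => g ω) (apply_sub_apply hTl (delta ω (-f ω)))
    have h2 : T (delta ω (-f ω)) ω - T (A (delta ω (-f ω))) ω = -f ω :=
      h1.trans (delta_self ω _)
    rw [h.apply_delta, hS, ← hf, sub_eq_iff_eq_add, neg_add_cancel] at h2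
    exact h2

end IsSectionOperator

end Green

/-- The map 1 - p sends ker q into ker p, injectively when no nonzero vector of ker q is fixed by p.
-/
theorem finrank_ker_le_of_forall {X : Type*} [NormedAddCommGroup X] [NormedSpace ℂ X]
    {p q : X →L[ℂ] X} (hp : ∀ x, p (p x) = p x) (h : ∀ x, q x = 0 → p x = x → x = 0)
    [FiniteDimensional ℂ p.ker] :
    FiniteDimensional ℂ q.ker ∧ Module.finrank ℂ q.ker ≤ Module.finrank ℂ p.ker := by
  let φ : q.ker →ₗ[ℂ] p.ker :=
    ((LinearMap.id - (p : X →ₗ[ℂ] X)).comp q.ker.subtype).codRestrict p.ker fun x => by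
      change p ((x : X) - p x) = 0
      rw [map_sub, hp, sub_self]
  have hφ : Function.Injective φ := by
    rw [← LinearMap.ker_eq_bot, LinearMap.ker_eq_bot']
    intro x hx
    have h1 : (x : X) - p x = 0 := congrArg Subtype.val hx
    exact Subtype.ext (h x x.2 (sub_eq_zero.1 h1).symm)
  exact ⟨FiniteDimensional.of_injective φ hφ, LinearMap.finrank_le_finrank_of_injective hφ⟩

/-! ### Persistence at one rate over an aperiodic base -/

section Perturbation

variable {Ω : Type*} {X : Ω → Type*} [∀ ω, NormedAddCommGroup (X ω)] [∀ ω, NormedSpace ℂ (X ω)]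
variable {σ : Equiv.Perm Ω}

theorem norm_le_of_mem_lasotaYorke {w : ∀ ω, Seminorm ℂ (X ω)} (hw : ∀ ω x, w ω x ≤ ‖x‖)
    {C₁ C₂ r R : ℝ} (hC₁ : 0 ≤ C₁) (hC₂ : 0 ≤ C₂) (hr : 0 ≤ r) (hR : 0 ≤ R) {S : BundleEnd X σ}
    (hS : S ∈ lasotaYorke w σ C₁ C₂ r R) (ω : Ω) : ‖S ω‖ ≤ C₁ * r + C₂ * R := by
  refine ContinuousLinearMap.opNorm_le_bound _ (by positivity) fun f => ?_
  have h1 : ‖S ω f‖ ≤ C₁ * r ^ 1 * ‖f‖ + C₂ * R ^ 1 * w ω f := hS ω f 1 le_rfl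
  have h2 : C₂ * R ^ 1 * w ω f ≤ C₂ * R ^ 1 * ‖f‖ := by gcongr; exact hw ω f
  linarith

theorem apply_rescale {w : ∀ ω, Seminorm ℂ (X ω)} {c : ℝ} (hc : 0 < c) (S : BundleEnd X σ)
    (ω : Ω) (f : X ω) : w (σ ω) (rescale c S ω f) = c⁻¹ * w (σ ω) (S ω f) := by
  rw [rescale, smul_apply, map_smul_eq_mul, Complex.norm_real,
    Real.norm_of_nonneg (inv_nonneg.2 hc.le)]

theorem rescale_sub_apply (c : ℝ) (S S' : BundleEnd X σ) (ω : Ω) (f : X ω) :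
    rescale c S ω f - rescale c S' ω f = rescale c (fun ω => S ω - S' ω) ω f := by
  simp [rescale, smul_sub]

/-- Persistence of the dichotomy at one rate `ρ` in the spectral gap, over an aperiodic base. -/
theorem Dichotomy.exists_perturbation [∀ ω, CompleteSpace (X ω)]
    (haper : ∀ ω, ∀ n : ℕ, 1 ≤ n → σ^[n] ω ≠ ω) {w : ∀ ω, Seminorm ℂ (X ω)}
    (hw : ∀ ω x, w ω x ≤ ‖x‖) {C₁ C₂ r R ρ : ℝ} (hC₁ : 0 ≤ C₁) (hC₂ : 0 ≤ C₂) (hr : 0 ≤ r)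
    (hR : 0 ≤ R) (hrρ : r < ρ) {L : BundleEnd X σ}
    (hL : ∀ η > 0, ∃ C > 0, ∀ ω, ∀ f : X ω, w (σ ω) (L ω f) ≤ η * ‖f‖ + C * w ω f)
    (hLY : L ∈ lasotaYorke w σ C₁ C₂ r R) {a b K₀ : ℝ} {p : ∀ ω, X ω →L[ℂ] X ω}
    (h : Dichotomy L a b K₀ p) (ha : 0 ≤ a) (haρ : a < ρ) (hρb : ρ < b) (hK₀ : 0 ≤ K₀) {d : ℕ}
    (hd : ∀ ω, FiniteDimensional ℂ (p ω).ker ∧ Module.finrank ℂ (p ω).ker = d) :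
    ∃ K > 0, ∀ δ > 0, ∃ ε > 0, ∀ S ∈ lasotaYorke w σ C₁ C₂ r R,
      (∀ ω f, w (σ ω) (L ω f - S ω f) ≤ ε * ‖f‖) →
      ∃ p' : ∀ ω, X ω →L[ℂ] X ω, Dichotomy S ρ ρ K p' ∧
        (∀ ω, FiniteDimensional ℂ (p' ω).ker ∧ Module.finrank ℂ (p' ω).ker = d) ∧
        ∀ ω x, w ω (p' ω x - p ω x) ≤ δ * ‖x‖ := by
  have hρ : 0 < ρ := hr.trans_lt hrρ
  have hbound {S : BundleEnd X σ} (hS : S ∈ lasotaYorke w σ C₁ C₂ r R) :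
      ∃ A, IsSectionOperator (rescale ρ S) A :=
    exists_isSectionOperator _ (by positivity) (norm_le_of_mem_lasotaYorke hw hC₁ hC₂
      (div_nonneg hr hρ.le) (div_nonneg hR hρ.le) (rescale_mem_lasotaYorke hρ hS))
  obtain ⟨A, hA⟩ := hbound hLY
  have hL₁ := h.to_rescale hρ
  obtain ⟨u, hu⟩ := hL₁.isUnit_one_sub (div_nonneg ha hρ.le) ((div_lt_one hρ).2 haρ)
    ((one_lt_div hρ).2 hρb) hK₀ hA
  set T : lp X ∞ →L[ℂ] lp X ∞ := ↑u⁻¹ with hT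
  have hTl : T * (1 - A) = 1 := by rw [← hu, hT, Units.inv_mul]
  have hTr : (1 - A) * T = 1 := by rw [← hu, hT, Units.mul_inv]
  -- The Green projection has rates (1, 1), and the rescaled gap of `L` strictly contains 1, so both
  -- nestings apply.
  have hpT : p = diagonal T := hL₁.eq_of_rates (hA.dichotomy haper hTl hTr)
    (div_nonneg ha hρ.le) zero_le_one ((div_lt_one hρ).2 haρ) ((one_lt_div hρ).2 hρb) hK₀
  have hLw : ∀ η > 0, ∃ C > 0, ∀ ω, ∀ f : X ω,
      w (σ ω) (rescale ρ L ω f) ≤ η * ‖f‖ + C * w ω f := by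
    intro η hη
    obtain ⟨C, hC, hLC⟩ := hL (ρ * η) (by positivity)
    refine ⟨ρ⁻¹ * C, by positivity, fun ω f => ?_⟩
    rw [apply_rescale hρ, inv_mul_le_iff₀ hρ]
    refine (hLC ω f).trans_eq ?_
    field_simp
  obtain ⟨K, hK, hKL⟩ := exists_inverse_one_sub_of_weakly_close hC₁ hC₂ (div_nonneg hr hρ.le)
    ((div_lt_one hρ).2 hrρ) (div_nonneg hR hρ.le) (supSeminorm_le_norm hw) hTl hTr
    (hA.weaklyContinuous hw hLw) (hA.lasotaYorkeBound hw hC₁ hC₂ (div_nonneg hr hρ.le)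
      (div_nonneg hR hρ.le) (rescale_mem_lasotaYorke hρ hLY))
  obtain ⟨c₀, hc₀, hc₀w⟩ := exists_norm_le_of_lasotaYorke (σ := σ) (X := X) (C₁ := C₁) hC₂ hr
    (hrρ.trans hρb) hR hK₀
  obtain ⟨c, hc, hcw⟩ := exists_norm_le_of_lasotaYorke (σ := σ) (X := X) (C₁ := C₁) hC₂ hr
    hrρ hR hK.le
  refine ⟨K, hK, fun δ hδ => ?_⟩
  -- The second threshold excludes a nonzero x killed by one projection and fixed by the other: the
  -- projections differ on x by ±x, whence w x ≤ ‖x‖ / (2 (c + c₀)) ≤ w x / 2.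
  obtain ⟨ε, hε, hKε⟩ := hKL (min δ (1 / (2 * (c + c₀)))) (by positivity)
  refine ⟨ρ * ε, by positivity, fun S hS hLS => ?_⟩
  obtain ⟨B, hB⟩ := hbound hS
  obtain ⟨T', hT'l, hT'r, hT'K, hT'T⟩ := hKε B
    (hB.lasotaYorkeBound hw hC₁ hC₂ (div_nonneg hr hρ.le) (div_nonneg hR hρ.le)
      (rescale_mem_lasotaYorke hρ hS))
    (hA.supSeminorm_sub_le hw hB hε.le fun ω f => by
      rw [rescale_sub_apply, apply_rescale hρ, inv_mul_le_iff₀ hρ, ← mul_assoc]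
      exact hLS ω f)
  have hD : Dichotomy S ρ ρ K (diagonal T') := by
    have := ((hB.dichotomy haper hT'l hT'r).mono zero_le_one hT'K).of_rescale hρ
    rwa [mul_one] at this
  have hclose (ω : Ω) (x : X ω) :
      w ω (diagonal T' ω x - p ω x) ≤ min δ (1 / (2 * (c + c₀))) * ‖x‖ := by
    have h1 := (le_supSeminorm hw ((T' - T) (delta ω x)) ω).trans (hT'T _)
    rw [norm_delta] at h1
    rwa [hpT]
  have hzero {ω : Ω} {x : X ω} (hx : w ω x ≤ min δ (1 / (2 * (c + c₀))) * ‖x‖)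
      (hx' : ‖x‖ ≤ (c + c₀) * w ω x) : x = 0 := by
    have h1 : w ω x ≤ 1 / (2 * (c + c₀)) * ((c + c₀) * w ω x) := by
      refine hx.trans ?_
      gcongr
      exact min_le_right _ _
    have h2 : 1 / (2 * (c + c₀)) * ((c + c₀) * w ω x) = w ω x / 2 := by field_simp
    have h3 : w ω x ≤ 0 := by linarith
    exact norm_le_zero_iff.1 (hx'.trans (mul_nonpos_of_nonneg_of_nonpos (by positivity) h3))
  refine ⟨diagonal T', hD, fun ω => ?_, fun ω x => (hclose ω x).trans ?_⟩
  · have := (hd ω).1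
    obtain ⟨h1, h2⟩ := finrank_ker_le_of_forall (p := p ω) (q := diagonal T' ω) (h.idem ω)
      fun x hx hpx => hzero
        (by simpa [hx, hpx] using hclose ω x)
        ((hcw w S _ ρ hS hD ω x hx).trans (by gcongr; linarith))
    obtain ⟨-, h4⟩ := finrank_ker_le_of_forall (p := diagonal T' ω) (q := p ω) (hD.idem ω)
      fun x hx hpx => hzero
        (by simpa [hx, hpx] using hclose ω x)
        ((hc₀w w L _ a hLY h ω x hx).trans (by gcongr; linarith))
    exact ⟨h1, le_antisymm (h2.trans_eq (hd ω).2) ((hd ω).2.ge.trans h4)⟩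
  · gcongr
    exact min_le_left _ _

end Perturbation

/-! ### Removing aperiodicity and opening a gap -/

section Unfolding

variable {Ω : Type*} {X : Ω → Type*} [∀ ω, NormedAddCommGroup (X ω)] [∀ ω, NormedSpace ℂ (X ω)]
variable {σ : Equiv.Perm Ω}

/-- The aperiodic extension `(k, ω) ↦ (k + 1, σ ω)` of `σ`. -/
def unfoldPerm (σ : Equiv.Perm Ω) : Equiv.Perm (ℤ × Ω) := (Equiv.addRight (1 : ℤ)).prodCongr σ

theorem unfoldPerm_iterate_fst (σ : Equiv.Perm Ω) (n : ℕ) (q : ℤ × Ω) :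
    ((unfoldPerm σ)^[n] q).1 = q.1 + n := by
  induction n generalizing q with
  | zero => simp
  | succ n ih =>
    rw [Function.iterate_succ_apply, ih]
    change q.1 + 1 + (n : ℤ) = _
    push_cast
    ring

theorem unfoldPerm_aperiodic (σ : Equiv.Perm Ω) (q : ℤ × Ω) (n : ℕ) (hn : 1 ≤ n) :
    (unfoldPerm σ)^[n] q ≠ q := fun h => by
  have := congrArg Prod.fst h
  rw [unfoldPerm_iterate_fst] at this
  omega

/-- The endomorphism over the aperiodic extension with the same fibre maps. -/
def unfold (S : BundleEnd X σ) : BundleEnd (fun q : ℤ × Ω => X q.2) (unfoldPerm σ) :=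
  fun q => S q.2

theorem norm_cocycle_unfold (S : BundleEnd X σ) (n : ℕ) (q : ℤ × Ω) (x : X q.2) :
    ‖cocycle (unfold S) n q x‖ = ‖cocycle S n q.2 x‖ := by
  induction n generalizing q with
  | zero => rfl
  | succ n ih => exact ih (unfoldPerm σ q) (S q.2 x)

theorem unfold_mem_lasotaYorke {w : ∀ ω, Seminorm ℂ (X ω)} {C₁ C₂ r R : ℝ} {S : BundleEnd X σ}
    (hS : S ∈ lasotaYorke w σ C₁ C₂ r R) :
    unfold S ∈ lasotaYorke (fun q : ℤ × Ω => w q.2) (unfoldPerm σ) C₁ C₂ r R := by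
  intro q f n hn
  rw [norm_cocycle_unfold]
  exact hS q.2 f n hn

theorem Dichotomy.to_unfold {S : BundleEnd X σ} {a b K : ℝ} {p : ∀ ω, X ω →L[ℂ] X ω}
    (h : Dichotomy S a b K p) : Dichotomy (unfold S) a b K (fun q => p q.2) where
  norm_le q := h.norm_le q.2
  idem q := h.idem q.2
  comm q := h.comm q.2
  decay q n hn x := by
    rw [norm_cocycle_unfold]
    exact h.decay q.2 n hn x
  expansion q n hn x hx := by
    rw [norm_cocycle_unfold]
    exact h.expansion q.2 n hn x hx
  surj q := h.surj q.2

/-- The unfolded cocycle ignores the integer coordinate, so translating its projections gives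
another dichotomy, to be compared with the first by uniqueness. -/
theorem Dichotomy.shift_of_unfold {S : BundleEnd X σ} {a b K : ℝ}
    {p : ∀ q : ℤ × Ω, X q.2 →L[ℂ] X q.2} (h : Dichotomy (unfold S) a b K p) :
    Dichotomy (unfold S) a b K (fun q => p (q.1 + 1, q.2)) where
  norm_le q := h.norm_le (q.1 + 1, q.2)
  idem q := h.idem (q.1 + 1, q.2)
  comm q := h.comm (q.1 + 1, q.2)
  decay q n hn x := by
    have := h.decay (q.1 + 1, q.2) n hn x
    rw [norm_cocycle_unfold] at this ⊢
    exact this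
  expansion q n hn x hx := by
    have := h.expansion (q.1 + 1, q.2) n hn x hx
    rw [norm_cocycle_unfold] at this ⊢
    exact this
  surj q := h.surj (q.1 + 1, q.2)

theorem Dichotomy.of_unfold {S : BundleEnd X σ} {a b K : ℝ}
    {p : ∀ q : ℤ × Ω, X q.2 →L[ℂ] X q.2} (h : Dichotomy (unfold S) a b K p)
    (hp : ∀ q : ℤ × Ω, p q = p (q.1 + 1, q.2)) :
    Dichotomy S a b K (fun ω => p (0, ω)) where
  norm_le ω := h.norm_le (0, ω)
  idem ω := h.idem (0, ω)
  comm ω x := by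
    rw [hp (0, σ ω)]
    exact h.comm (0, ω) x
  decay ω n hn x := by
    have := h.decay (0, ω) n hn x
    rwa [norm_cocycle_unfold] at this
  expansion ω n hn x hx := by
    have := h.expansion (0, ω) n hn x hx
    rwa [norm_cocycle_unfold] at this
  surj ω x hx := by
    rw [hp (0, σ ω)] at hx
    exact h.surj (0, ω) x hx

/-- Persistence of a dichotomy under perturbations that are small in the triple norm and satisfy
a common Lasota-Yorke bound. -/
theorem Dichotomy.exists_perturbation_of_gap [∀ ω, CompleteSpace (X ω)]
    {w : ∀ ω, Seminorm ℂ (X ω)} (hw : ∀ ω x, w ω x ≤ ‖x‖) {C₁ C₂ r R ρ₁ ρ₂ : ℝ} (hC₁ : 0 ≤ C₁)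
    (hC₂ : 0 ≤ C₂) (hr : 0 ≤ r) (hR : 0 ≤ R) (hrρ : r < ρ₁) {L : BundleEnd X σ}
    (hL : ∀ η > 0, ∃ C > 0, ∀ ω, ∀ f : X ω, w (σ ω) (L ω f) ≤ η * ‖f‖ + C * w ω f)
    (hLY : L ∈ lasotaYorke w σ C₁ C₂ r R) {a b K₀ : ℝ} {p : ∀ ω, X ω →L[ℂ] X ω}
    (h : Dichotomy L a b K₀ p) (ha : 0 ≤ a) (haρ : a < ρ₁) (hρ₁₂ : ρ₁ < ρ₂) (hρb : ρ₂ < b)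
    (hK₀ : 0 ≤ K₀) {d : ℕ}
    (hd : ∀ ω, FiniteDimensional ℂ (p ω).ker ∧ Module.finrank ℂ (p ω).ker = d) :
    ∃ K > 0, ∀ δ > 0, ∃ ε > 0, ∀ S ∈ lasotaYorke w σ C₁ C₂ r R,
      (∀ ω f, w (σ ω) (L ω f - S ω f) ≤ ε * ‖f‖) →
      ∃ p' : ∀ ω, X ω →L[ℂ] X ω, Dichotomy S ρ₁ ρ₂ K p' ∧
        (∀ ω, FiniteDimensional ℂ (p' ω).ker ∧ Module.finrank ℂ (p' ω).ker = d) ∧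
        ∀ ω x, w ω (p' ω x - p ω x) ≤ δ * ‖x‖ := by
  have hρ₁ : 0 ≤ ρ₁ := ha.trans haρ.le
  obtain ⟨K₁, hK₁, H₁⟩ := h.to_unfold.exists_perturbation (unfoldPerm_aperiodic σ)
    (w := fun q => w q.2) (fun q => hw q.2) hC₁ hC₂ hr hR hrρ
    (fun η hη => (hL η hη).imp fun C hC => ⟨hC.1, fun q => hC.2 q.2⟩)
    (unfold_mem_lasotaYorke hLY) ha haρ (hρ₁₂.trans hρb) hK₀ (fun q => hd q.2)
  obtain ⟨K₂, hK₂, H₂⟩ := h.to_unfold.exists_perturbation (unfoldPerm_aperiodic σ)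
    (w := fun q => w q.2) (fun q => hw q.2) hC₁ hC₂ hr hR (hrρ.trans hρ₁₂)
    (fun η hη => (hL η hη).imp fun C hC => ⟨hC.1, fun q => hC.2 q.2⟩)
    (unfold_mem_lasotaYorke hLY) ha (haρ.trans hρ₁₂) hρb hK₀ (fun q => hd q.2)
  refine ⟨max K₁ K₂, by positivity, fun δ hδ => ?_⟩
  obtain ⟨ε₁, hε₁, H₁⟩ := H₁ δ hδ
  obtain ⟨ε₂, hε₂, H₂⟩ := H₂ δ hδ
  refine ⟨min ε₁ ε₂, by positivity, fun S hS hLS => ?_⟩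
  obtain ⟨p₁, hp₁, hd₁, hδ₁⟩ := H₁ (unfold S) (unfold_mem_lasotaYorke hS) fun q f =>
    (hLS q.2 f).trans (by gcongr; exact min_le_left _ _)
  obtain ⟨p₂, hp₂, hd₂, -⟩ := H₂ (unfold S) (unfold_mem_lasotaYorke hS) fun q f =>
    (hLS q.2 f).trans (by gcongr; exact min_le_right _ _)
  -- Each dichotomy alone has equal slow and fast rates; they can be compared only because ρ₁ < ρ₂
  -- and the dimensions agree.
  have e : p₁ = p₂ := funext fun q =>
    hp₁.eq_of_finrank_eq hp₂ hρ₁ hρ₁₂ hK₁.le hK₂.le q (hd₁ q) (hd₂ q)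
  subst e
  have hp₁' := hp₁.mono hρ₁ (le_max_left K₁ K₂)
  have hp₂' := hp₂.mono (hρ₁.trans hρ₁₂.le) (le_max_right K₁ K₂)
  have hp : Dichotomy (unfold S) ρ₁ ρ₂ (max K₁ K₂) p₁ :=
    { hp₁' with expansion := hp₂'.expansion }
  have hK : 0 ≤ max K₁ K₂ := by positivity
  -- Uniqueness applies here only now that decay at ρ₁ and expansion at ρ₂ have been combined into a
  -- strict gap.
  have hshift (q : ℤ × Ω) : p₁ q = p₁ (q.1 + 1, q.2) :=
    hp.eq_of_finrank_eq hp.shift_of_unfold hρ₁ hρ₁₂ hK hK q (hd₁ q) (hd₁ (q.1 + 1, q.2))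
  exact ⟨fun ω => p₁ (0, ω), hp.of_unfold hshift, fun ω => hd₁ (0, ω), fun ω => hδ₁ (0, ω)⟩

end Unfolding

/-! ### Triple norm and Grassmannian distance -/

section TripleNorm

variable {X : Type*} [NormedAddCommGroup X] [NormedSpace ℂ X]

theorem apply_le_of_tripleNorm_le {Y : Type*} [NormedAddCommGroup Y] [NormedSpace ℂ Y]
    {w : Seminorm ℂ Y} {A : X →L[ℂ] Y} {c : ℝ} (hc : 0 ≤ c)
    (h : tripleNorm w A ≤ ENNReal.ofReal c) (f : X) : w (A f) ≤ c * ‖f‖ := by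
  rcases eq_or_ne f 0 with rfl | hf
  · simp
  have hf' : ‖f‖ ≠ 0 := norm_ne_zero_iff.2 hf
  have hu : ‖((‖f‖⁻¹ : ℝ) : ℂ) • f‖ = 1 := by
    rw [norm_smul, Complex.norm_real, norm_inv, norm_norm, inv_mul_cancel₀ hf']
  have h1 : ENNReal.ofReal (w (A (((‖f‖⁻¹ : ℝ) : ℂ) • f))) ≤ ENNReal.ofReal c :=
    (le_iSup₂ (f := fun (g : X) (_ : ‖g‖ = 1) => ENNReal.ofReal (w (A g))) _ hu).trans h
  rw [ENNReal.ofReal_le_ofReal_iff hc, map_smul, map_smul_eq_mul, Complex.norm_real, norm_inv,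
    norm_norm, inv_mul_le_iff₀ (norm_pos_iff.2 hf)] at h1
  linarith

theorem tripleNorm_le {Y : Type*} [NormedAddCommGroup Y] [NormedSpace ℂ Y]
    {w : Seminorm ℂ Y} {A : X →L[ℂ] Y} {c : ℝ} (h : ∀ f, w (A f) ≤ c * ‖f‖) :
    tripleNorm w A ≤ ENNReal.ofReal c :=
  iSup₂_le fun f hf => ENNReal.ofReal_le_ofReal ((h f).trans_eq (by rw [hf, mul_one]))

/-- Normalising `f` moves it by |1 - ‖f‖| ≤ η, hence the factor 2; η < 1 keeps `f` nonzero. -/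
theorem exists_unit_vector_near (F : Submodule ℂ X) {e f : X} {η : ℝ} (he : ‖e‖ = 1) (hf : f ∈ F)
    (hη : η < 1) (h : ‖e - f‖ ≤ η) : ∃ g ∈ F, ‖g‖ = 1 ∧ ‖e - g‖ ≤ 2 * η := by
  have h1 : |‖e‖ - ‖f‖| ≤ η := (abs_norm_sub_norm_le e f).trans h
  rw [he] at h1
  have hf0 : 0 < ‖f‖ := by have := (abs_le.1 h1).2; linarith
  refine ⟨((‖f‖⁻¹ : ℝ) : ℂ) • f, F.smul_mem _ hf, ?_, ?_⟩
  · rw [norm_smul, Complex.norm_real, norm_inv, norm_norm, inv_mul_cancel₀ hf0.ne']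
  · have h2 : ‖f - ((‖f‖⁻¹ : ℝ) : ℂ) • f‖ = |1 - ‖f‖| := by
      have e1 : f - ((‖f‖⁻¹ : ℝ) : ℂ) • f = ((1 - ‖f‖⁻¹ : ℝ) : ℂ) • f := by
        push_cast; rw [sub_smul, one_smul]
      have e2 : (1 - ‖f‖⁻¹) * ‖f‖ = ‖f‖ - 1 := by field_simp
      rw [e1, norm_smul, Complex.norm_real, Real.norm_eq_abs]
      calc |1 - ‖f‖⁻¹| * ‖f‖ = |(1 - ‖f‖⁻¹) * ‖f‖| := by rw [abs_mul, abs_of_pos hf0]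
        _ = |1 - ‖f‖| := by rw [e2, abs_sub_comm]
    calc ‖e - ((‖f‖⁻¹ : ℝ) : ℂ) • f‖ ≤ ‖e - f‖ + ‖f - ((‖f‖⁻¹ : ℝ) : ℂ) • f‖ :=
          norm_sub_le_norm_sub_add_norm_sub _ _ _
      _ ≤ 2 * η := by rw [h2]; linarith

theorem grassmannianDist_le {F F' : Submodule ℂ X} {δ : ℝ}
    (h : ∀ e ∈ F, ‖e‖ = 1 → ∃ f ∈ F', ‖f‖ = 1 ∧ ‖e - f‖ ≤ δ)
    (h' : ∀ e ∈ F', ‖e‖ = 1 → ∃ f ∈ F, ‖f‖ = 1 ∧ ‖e - f‖ ≤ δ) :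
    grassmannianDist F F' ≤ ENNReal.ofReal δ := by
  refine max_le (iSup₂_le fun e he => ?_) (iSup₂_le fun f hf => ?_)
  · obtain ⟨f, hf, hf1, hef⟩ := h e he.1 he.2
    exact (iInf₂_le f ⟨hf, hf1⟩).trans (ENNReal.ofReal_le_ofReal hef)
  · obtain ⟨e, he, he1, hfe⟩ := h' f hf.1 hf.2
    rw [norm_sub_rev] at hfe
    exact (iInf₂_le e ⟨he, he1⟩).trans (ENNReal.ofReal_le_ofReal hfe)

/-- Projections that are close in the weak norm have strongly close ranges when the weak norm
dominates the strong norm on the kernel of the target projection. -/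
theorem exists_unit_vector_mem_range_near {w : Seminorm ℂ X} {p p' : X →L[ℂ] X} {c η : ℝ}
    (hc : 0 ≤ c) (hη : c * η < 1) (hp : ∀ x, p (p x) = p x) (hpc : ∀ x, p x = 0 → ‖x‖ ≤ c * w x)
    (hpp' : ∀ x, w (p' x - p x) ≤ η * ‖x‖) {F : Submodule ℂ X} (hF : ∀ x, p x ∈ F) {e : X}
    (he : p' e = e) (he1 : ‖e‖ = 1) : ∃ g ∈ F, ‖g‖ = 1 ∧ ‖e - g‖ ≤ 2 * (c * η) := by
  refine exists_unit_vector_near F he1 (hF e) hη ?_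
  refine (hpc _ (by rw [map_sub, hp, sub_self])).trans ?_
  have := hpp' e
  rw [he, he1, mul_one] at this
  gcongr

end TripleNorm

/-! ### Hyperbolic splittings as dichotomies -/

section Splitting

variable {Ω : Type*} {X : Ω → Type*} [∀ ω, NormedAddCommGroup (X ω)] [∀ ω, NormedSpace ℂ (X ω)]
variable {σ : Equiv.Perm Ω}

theorem sub_apply_le_of_mem_tripleBall {w : ∀ ω, Seminorm ℂ (X ω)} {L S : BundleEnd X σ} {ε : ℝ}
    (hε : 0 ≤ ε) (h : S ∈ tripleBall w L ε) (ω : Ω) (f : X ω) :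
    w (σ ω) (L ω f - S ω f) ≤ ε * ‖f‖ :=
  apply_le_of_tripleNorm_le hε
    ((le_iSup (fun ω => tripleNorm (w (σ ω)) (L ω - S ω)) ω).trans (le_of_lt h)) f

theorem tripleBall_mono {w : ∀ ω, Seminorm ℂ (X ω)} {L : BundleEnd X σ} {ε ε' : ℝ}
    (h : ε ≤ ε') : tripleBall w L ε ⊆ tripleBall w L ε' :=
  fun _ hS => lt_of_lt_of_le hS (ENNReal.ofReal_le_ofReal h)

namespace IsHyperbolicSplitting

variable {S : BundleEnd X σ} {μ lam : ℝ} {d : ℕ} {E F : ∀ ω, Submodule ℂ (X ω)}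

/-- The projections onto the slow spaces along the fast spaces. -/
def slowProjection (h : IsHyperbolicSplitting S μ lam d E F) (ω : Ω) : X ω →L[ℂ] X ω :=
  (F ω).projectionL (E ω) (h.isTopCompl ω).symm

theorem slowProjection_mem (h : IsHyperbolicSplitting S μ lam d E F) (ω : Ω) (x : X ω) :
    h.slowProjection ω x ∈ F ω :=
  Submodule.projectionL_apply_mem _ x

theorem slowProjection_eq_zero_iff (h : IsHyperbolicSplitting S μ lam d E F) {ω : Ω} {x : X ω} :
    h.slowProjection ω x = 0 ↔ x ∈ E ω :=
  Submodule.projectionL_apply_eq_zero_iff _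

theorem slowProjection_eq_self_iff (h : IsHyperbolicSplitting S μ lam d E F) {ω : Ω} {x : X ω} :
    h.slowProjection ω x = x ↔ x ∈ F ω :=
  Submodule.projectionL_eq_self_iff _ x

theorem sub_slowProjection_mem (h : IsHyperbolicSplitting S μ lam d E F) (ω : Ω) (x : X ω) :
    x - h.slowProjection ω x ∈ E ω := by
  rw [← h.slowProjection_eq_zero_iff, map_sub, sub_eq_zero]
  exact (h.slowProjection_eq_self_iff.2 (h.slowProjection_mem ω x)).symm

theorem projectionL_eq (h : IsHyperbolicSplitting S μ lam d E F) (ω : Ω) :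
    (E ω).projectionL (F ω) (h.isTopCompl ω) = .id ℂ (X ω) - h.slowProjection ω :=
  Submodule.projectionL_eq_id_sub_projectionL (h.isTopCompl ω).symm

theorem ker_slowProjection (h : IsHyperbolicSplitting S μ lam d E F) (ω : Ω) :
    FiniteDimensional ℂ (h.slowProjection ω).ker ∧
      Module.finrank ℂ (h.slowProjection ω).ker = d := by
  have e : (h.slowProjection ω).ker = E ω := Submodule.ker_projectionL _
  rw [e]
  exact h.fast_mem ω

theorem apply_mem_slow (h : IsHyperbolicSplitting S μ lam d E F) {ω : Ω} {x : X ω}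
    (hx : x ∈ F ω) : S ω x ∈ F (σ ω) :=
  h.slow_map ω (Submodule.mem_map_of_mem hx)

theorem apply_mem_fast (h : IsHyperbolicSplitting S μ lam d E F) {ω : Ω} {x : X ω}
    (hx : x ∈ E ω) : S ω x ∈ E (σ ω) :=
  h.fast_map ω ▸ Submodule.mem_map_of_mem hx

theorem exists_dichotomy (h : IsHyperbolicSplitting S μ lam d E F) :
    ∃ K > 0, Dichotomy S μ lam K h.slowProjection := by
  obtain ⟨Θ, hΘ, hΘ'⟩ := h.projection_bound
  obtain ⟨C, hC, hfast⟩ := h.fast_expansion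
  obtain ⟨D, hD, hslow⟩ := h.slow_decay
  have hμ := h.rate_nonneg
  have hnorm (ω : Ω) : ‖h.slowProjection ω‖ ≤ Θ := (le_max_left _ _).trans (hΘ' ω)
  refine ⟨Θ + D * Θ + C⁻¹, by positivity, ?_, ?_, ?_, ?_, ?_, ?_⟩
  · intro ω
    refine (hnorm ω).trans ?_
    have : 0 < D * Θ := by positivity
    have : 0 < C⁻¹ := by positivity
    linarith
  · exact fun ω x => h.slowProjection_eq_self_iff.2 (h.slowProjection_mem ω x)
  · intro ω x
    have h1 : S ω x = S ω (h.slowProjection ω x) + S ω (x - h.slowProjection ω x) := by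
      rw [← map_add]; congr 1; abel
    rw [h1, map_add, h.slowProjection_eq_self_iff.2 (h.apply_mem_slow (h.slowProjection_mem ω x)),
      h.slowProjection_eq_zero_iff.2 (h.apply_mem_fast (h.sub_slowProjection_mem ω x)), add_zero]
  · intro ω n hn x
    have h1 : ‖cocycle S n ω (h.slowProjection ω x)‖ ≤ D * μ ^ n * ‖h.slowProjection ω x‖ :=
      ((cocycle S n ω).comp (F ω).subtypeL).le_of_opNorm_le (hslow ω n hn)
        ⟨_, h.slowProjection_mem ω x⟩
    have h2 : ‖h.slowProjection ω x‖ ≤ Θ * ‖x‖ := ContinuousLinearMap.le_of_opNorm_le _ (hnorm ω) x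
    calc _ ≤ D * μ ^ n * (Θ * ‖x‖) := h1.trans (by gcongr)
      _ = (0 + D * Θ + 0) * μ ^ n * ‖x‖ := by ring
      _ ≤ _ := by gcongr; positivity
  · intro ω n hn x hx
    have h1 := hfast ω n hn x (h.slowProjection_eq_zero_iff.1 hx)
    calc lam ^ n * ‖x‖ = C⁻¹ * (C * lam ^ n * ‖x‖) := by field_simp
      _ ≤ C⁻¹ * ‖cocycle S n ω x‖ := by gcongr
      _ ≤ _ := by
        gcongr
        have : 0 < Θ + D * Θ := by positivity
        linarith
  · intro ω x hx
    rw [h.slowProjection_eq_zero_iff, ← h.fast_map] at hx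
    obtain ⟨y, hy, hyx⟩ := hx
    exact ⟨y, h.slowProjection_eq_zero_iff.2 hy, hyx⟩

variable {a b K : ℝ} {p : ∀ ω, X ω →L[ℂ] X ω}

/-- The rates of the splitting are arbitrary, but one comparison always holds: either μ < b, or a <
b ≤ μ < lam. -/
theorem slowProjection_eq (h : IsHyperbolicSplitting S μ lam d E F) (hp : Dichotomy S a b K p)
    (ha : 0 ≤ a) (hab : a < b) (hK : 0 ≤ K)
    (hd : ∀ ω, FiniteDimensional ℂ (p ω).ker ∧ Module.finrank ℂ (p ω).ker = d) :
    h.slowProjection = p := by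
  obtain ⟨K', hK', hh⟩ := h.exists_dichotomy
  funext ω
  rcases lt_or_ge μ b with hb | hb
  · exact hh.eq_of_finrank_eq hp h.rate_nonneg hb hK'.le hK ω (h.ker_slowProjection ω) (hd ω)
  · exact (hp.eq_of_finrank_eq hh ha ((hab.trans_le hb).trans h.rate_lt) hK hK'.le ω (hd ω)
      (h.ker_slowProjection ω)).symm

theorem norm_comp_subtypeL_le (h : IsHyperbolicSplitting S μ lam d E F)
    (hp : Dichotomy S a b K h.slowProjection) (ha : 0 ≤ a) (hK : 0 ≤ K) (ω : Ω) (n : ℕ)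
    (hn : 1 ≤ n) : ‖(cocycle S n ω).comp (F ω).subtypeL‖ ≤ K * a ^ n := by
  refine ContinuousLinearMap.opNorm_le_bound _ (by positivity) fun x => ?_
  have := hp.decay ω n hn x
  rwa [h.slowProjection_eq_self_iff.2 x.2] at this

theorem le_norm_cocycle (h : IsHyperbolicSplitting S μ lam d E F)
    (hp : Dichotomy S a b K h.slowProjection) (hK : 0 < K) (ω : Ω) (n : ℕ) (hn : 1 ≤ n) (v : X ω)
    (hv : v ∈ E ω) : K⁻¹ * b ^ n * ‖v‖ ≤ ‖cocycle S n ω v‖ := by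
  have := hp.expansion ω n hn v (h.slowProjection_eq_zero_iff.2 hv)
  rw [mul_assoc, inv_mul_le_iff₀ hK]
  exact this

theorem change_rates (h : IsHyperbolicSplitting S μ lam d E F)
    (hp : Dichotomy S a b K h.slowProjection) (ha : 0 ≤ a) (hab : a < b) (hK : 0 < K) :
    IsHyperbolicSplitting S a b d E F :=
  { h with
    rate_nonneg := ha
    rate_lt := hab
    fast_expansion := ⟨K⁻¹, inv_pos.2 hK, fun ω n hn v hv => h.le_norm_cocycle hp hK ω n hn v hv⟩
    slow_decay := ⟨K, hK, fun ω n hn => h.norm_comp_subtypeL_le hp ha hK.le ω n hn⟩ }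

end IsHyperbolicSplitting

theorem Dichotomy.isHyperbolicSplitting {S : BundleEnd X σ} {a b K : ℝ}
    {p : ∀ ω, X ω →L[ℂ] X ω} (h : Dichotomy S a b K p) (ha : 0 ≤ a) (hab : a < b) (hK : 0 < K)
    {d : ℕ} (hd0 : 0 < d)
    (hd : ∀ ω, FiniteDimensional ℂ (p ω).ker ∧ Module.finrank ℂ (p ω).ker = d) :
    IsHyperbolicSplitting S a b d (fun ω => (p ω).ker) (fun ω => (p ω).range) := by
  have hidem (ω : Ω) : IsIdempotentElem (p ω) := ContinuousLinearMap.ext (h.idem ω)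
  have hc (ω : Ω) : (p ω).range.IsTopCompl (p ω).ker := ContinuousLinearMap.IsIdempotentElem.isTopCompl (hidem ω)
  have hrange {ω : Ω} {x : X ω} (hx : x ∈ (p ω).range) : p ω x = x := by
    obtain ⟨y, rfl⟩ := hx
    exact h.idem ω y
  refine ⟨hd0, ha, hab, hd, fun ω => ?_, fun ω => (hc ω).symm, ?_, fun ω => ?_, ?_, fun ω => ?_, ?_⟩
  · have := (hd ω).1
    have e := Submodule.quotientEquivOfIsCompl _ _ (hc ω).isCompl
    exact ⟨(hc ω).isClosed, e.symm.finiteDimensional, e.finrank_eq.trans (hd ω).2⟩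
  · refine ⟨1 + K, by positivity, fun ω => ?_⟩
    have e1 := ContinuousLinearMap.IsIdempotentElem.eq_projectionL (hidem ω)
    have e2 := Submodule.projectionL_eq_id_sub_projectionL (hc ω)
    rw [← e1] at e2
    rw [e2, ← e1]
    refine max_le ((h.norm_le ω).trans (by linarith)) ?_
    exact ContinuousLinearMap.opNorm_le_bound _ (by positivity) (h.norm_sub_apply_le ω)
  · ext x
    constructor
    · rintro ⟨y, hy, rfl⟩
      change p (σ ω) (S ω y) = 0
      rw [h.comm, show p ω y = 0 from hy, map_zero]
    · intro hx
      obtain ⟨y, hy, hyx⟩ := h.surj ω x hx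
      exact ⟨y, hy, hyx⟩
  · refine ⟨K⁻¹, inv_pos.2 hK, fun ω n hn f hf => ?_⟩
    rw [mul_assoc, inv_mul_le_iff₀ hK]
    exact h.expansion ω n hn f hf
  · rintro _ ⟨y, hy, rfl⟩
    refine ⟨S ω y, ?_⟩
    change p (σ ω) (S ω y) = S ω y
    rw [h.comm, hrange hy]
  · refine ⟨K, hK, fun ω n hn => ContinuousLinearMap.opNorm_le_bound _ (by positivity) fun x => ?_⟩
    have := h.decay ω n hn x
    rwa [hrange x.2] at this

end Splitting

end SaksStability

end

/-! ### The stability theorem -/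

open SaksStability in
theorem mainTheorem1 {Ω : Type*} (σ : Equiv.Perm Ω) (X : Ω → Type*)
    [∀ ω, NormedAddCommGroup (X ω)] [∀ ω, NormedSpace ℂ (X ω)] [∀ ω, CompleteSpace (X ω)]
    (w : ∀ ω, Seminorm ℂ (X ω)) (hw : ∀ ω, IsNormalSaks (w ω))
    (μ lam C₁ C₂ r R : ℝ) (hC₁ : 0 ≤ C₁) (hC₂ : 0 ≤ C₂) (hR : 0 ≤ R)
    (hr : 0 ≤ r) (hrμ : r < μ) (hμlam : μ < lam) (d : ℕ) (hd : 0 < d)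
    (E F : ∀ ω, Submodule ℂ (X ω)) (L : BundleEnd X σ)
    (hLS : IsSaksEquicontinuous w L) (hLY : L ∈ lasotaYorke w σ C₁ C₂ r R)
    (hL : IsHyperbolicSplitting L μ lam d E F) :
    ∃ ε' > 0,
      (∀ S ∈ lasotaYorke w σ C₁ C₂ r R ∩ tripleBall w L ε', HasHyperbolicSplitting S d) ∧
      (∃ M : ℝ, ∀ S ∈ lasotaYorke w σ C₁ C₂ r R ∩ tripleBall w L ε',
        ∀ (μ' lam' : ℝ) (ES FS : ∀ ω, Submodule ℂ (X ω))
          (h : IsHyperbolicSplitting S μ' lam' d ES FS),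
          ∀ ω, ‖(ES ω).projectionL (FS ω) (h.isTopCompl ω)‖ ≤ M) ∧
      ∀ β ∈ Set.Ioo 0 ((lam - μ) / 2), ∃ Cβ > 0, ∀ δ > 0, ∃ ε ∈ Set.Ioo 0 ε',
        ∀ S ∈ lasotaYorke w σ C₁ C₂ r R ∩ tripleBall w L ε,
        ∀ (μ' lam' : ℝ) (ES FS : ∀ ω, Submodule ℂ (X ω))
          (h : IsHyperbolicSplitting S μ' lam' d ES FS),
          (⨆ ω, tripleNorm (w ω) ((ES ω).projectionL (FS ω) (h.isTopCompl ω) -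
              (E ω).projectionL (F ω) (hL.isTopCompl ω))) ≤ ENNReal.ofReal δ ∧
          (⨆ ω, grassmannianDist (FS ω) (F ω)) ≤ ENNReal.ofReal δ ∧
          IsHyperbolicSplitting S (μ + β) (lam - β) d ES FS ∧
          (∀ ω, ∀ n : ℕ, 1 ≤ n →
            ‖(cocycle S n ω).comp (FS ω).subtypeL‖ ≤ Cβ * (μ + β) ^ n) ∧
          (∀ ω, ∀ n : ℕ, 1 ≤ n → ∀ v ∈ ES ω,
            Cβ⁻¹ * (lam - β) ^ n * ‖v‖ ≤ ‖cocycle S n ω v‖) := by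
  have hwn : ∀ ω x, w ω x ≤ ‖x‖ := fun ω => (hw ω).le_norm
  have hμ : 0 ≤ μ := hr.trans hrμ.le
  obtain ⟨K₀, hK₀, hLD⟩ := hL.exists_dichotomy
  have pert {β : ℝ} (hβ : β ∈ Set.Ioo 0 ((lam - μ) / 2)) :=
    hLD.exists_perturbation_of_gap hwn hC₁ hC₂ hr hR (show r < μ + β by linarith [hβ.1])
      hLS.weak_bound hLY hμ (show μ < μ + β by linarith [hβ.1])
      (show μ + β < lam - β by linarith [hβ.2]) (show lam - β < lam by linarith [hβ.1]) hK₀.le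
      hL.ker_slowProjection
  -- Any admissible β would fix ε' and the bound M; closeness plays no role there, so δ = 1 will do.
  have hβ₀ : (lam - μ) / 4 ∈ Set.Ioo 0 ((lam - μ) / 2) := ⟨by linarith, by linarith⟩
  obtain ⟨K, hK, hpert⟩ := pert hβ₀
  obtain ⟨ε', hε', hpert⟩ := hpert 1 one_pos
  have ha₀ : 0 ≤ μ + (lam - μ) / 4 := by linarith [hβ₀.1]
  have hab₀ : μ + (lam - μ) / 4 < lam - (lam - μ) / 4 := by linarith [hβ₀.2]
  refine ⟨ε', hε', fun S hS => ?_, ⟨1 + K, fun S hS μ' lam' ES FS h ω => ?_⟩, fun β hβ => ?_⟩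
  · obtain ⟨p, hp, hpd, -⟩ := hpert S hS.1 (sub_apply_le_of_mem_tripleBall hε'.le hS.2)
    exact ⟨_, _, _, _, hp.isHyperbolicSplitting ha₀ hab₀ hK hd hpd⟩
  · obtain ⟨p, hp, hpd, -⟩ := hpert S hS.1 (sub_apply_le_of_mem_tripleBall hε'.le hS.2)
    rw [h.projectionL_eq, h.slowProjection_eq hp ha₀ hab₀ hK.le hpd]
    exact ContinuousLinearMap.opNorm_le_bound _ (by positivity) (hp.norm_sub_apply_le ω)
  · have ha : 0 ≤ μ + β := by linarith [hβ.1]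
    have hab : μ + β < lam - β := by linarith [hβ.2]
    obtain ⟨Kβ, hKβ, hpert⟩ := pert hβ
    obtain ⟨c₀, hc₀, hc₀w⟩ := exists_norm_le_of_lasotaYorke (σ := σ) (X := X) (C₁ := C₁) hC₂ hr
      (hrμ.trans hμlam) hR hK₀.le
    obtain ⟨c, hc, hcw⟩ := exists_norm_le_of_lasotaYorke (σ := σ) (X := X) (C₁ := C₁) (b := lam - β)
      hC₂ hr (by linarith [hβ.1]) hR hKβ.le
    refine ⟨Kβ, hKβ, fun δ hδ => ?_⟩
    -- The entry δ serves the projections. The other serves the slow spaces: δ / 2 offsets the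
    -- doubling by normalisation, and 1 / 2 keeps (c + c₀) η below 1.
    set η : ℝ := min δ (min (δ / 2) (1 / 2) / (c + c₀)) with hη
    have hη0 : 0 < η := by positivity
    have hcη : (c + c₀) * η ≤ min (δ / 2) (1 / 2) := by
      have := min_le_right δ (min (δ / 2) (1 / 2) / (c + c₀))
      rw [← hη, le_div_iff₀ (by positivity)] at this
      linarith
    have hcη1 : (c + c₀) * η < 1 := by linarith [hcη.trans (min_le_right _ _)]
    have hcη2 : 2 * ((c + c₀) * η) ≤ δ := by linarith [hcη.trans (min_le_left _ _)]
    obtain ⟨ε, hε, hpert⟩ := hpert η hη0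
    refine ⟨min ε (ε' / 2), ⟨by positivity, (min_le_right _ _).trans_lt (by linarith)⟩,
      fun S hS μ' lam' ES FS h => ?_⟩
    obtain ⟨p, hp, hpd, hpη⟩ := hpert S hS.1
      (sub_apply_le_of_mem_tripleBall hε.le (tripleBall_mono (min_le_left _ _) hS.2))
    -- The given splitting of `S` is the constructed one, so every estimate transfers whatever its
    -- original rates.
    obtain rfl := h.slowProjection_eq hp ha hab hKβ.le hpd
    refine ⟨iSup_le fun ω => tripleNorm_le fun f => ?_, iSup_le fun ω => ?_,
      h.change_rates hp ha hab hKβ, h.norm_comp_subtypeL_le hp ha hKβ.le,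
      h.le_norm_cocycle hp hKβ⟩
    · have e : ((ES ω).projectionL (FS ω) (h.isTopCompl ω) -
          (E ω).projectionL (F ω) (hL.isTopCompl ω)) f =
          -(h.slowProjection ω f - hL.slowProjection ω f) := by
        rw [h.projectionL_eq, hL.projectionL_eq]
        change f - h.slowProjection ω f - (f - hL.slowProjection ω f) = _
        abel
      rw [e, map_neg_eq_map]
      exact (hpη ω f).trans (by gcongr; exact min_le_left _ _)
    -- A unit vector of one slow space is projected to the other; the error is in the target's fast
    -- space, where weakly small means strongly small. Thus c₀ serves `L` and c serves `S`.
    · refine grassmannianDist_le (fun e he he1 => ?_) fun e he he1 => ?_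
      · obtain ⟨g, hg, hg1, hge⟩ := exists_unit_vector_mem_range_near (w := w ω)
          (add_pos hc hc₀).le hcη1 (hLD.idem ω)
          (fun x hx => (hc₀w w L _ _ hLY hLD ω x hx).trans (by gcongr; linarith))
          (hpη ω) (hL.slowProjection_mem ω) (h.slowProjection_eq_self_iff.2 he) he1
        exact ⟨g, hg, hg1, hge.trans hcη2⟩
      · obtain ⟨g, hg, hg1, hge⟩ := exists_unit_vector_mem_range_near (w := w ω)
          (p' := hL.slowProjection ω) (add_pos hc hc₀).le hcη1 (hp.idem ω)
          (fun x hx => (hcw w S _ _ hS.1 hp ω x hx).trans (by gcongr; linarith))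
          (fun x => by rw [map_sub_rev]; exact hpη ω x)
          (h.slowProjection_mem ω) (hL.slowProjection_eq_self_iff.2 he) he1
        exact ⟨g, hg, hg1, hge.trans hcη2⟩
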